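/- Let $F$ be a nonarchimedean local field of characteristic $0$ with ring of integers $\mathcal O$, maximal ideal $\mathfrak p$, uniformizer $\varpi$ and residue field of cardinality $q$. Let $D\in F^\times$, let $E=F[x]/(x^2-D)$ (a quadratic field extension of $F$, or $F\times F$ if $D$ is a square), write $\sqrt D$ for the class of $x$, and embed $E^\times$ into $\mathrm{GL}_2(F)$ by $a+b\sqrt D\mapsto\begin{pmatrix}a&b\\ bD&a\end{pmatrix}$. Fix a Haar measure $de$ on $F^\times\backslash E^\times$. Let $\pi$ be an infinite-dimensional irreducible admissible complex representation of $\mathrm{GL}_2(F)$ that is either unramified (it has a nonzero $\mathrm{GL}_2(\mathcal O)$-fixed vector) or special unramified (isomorphic to $\mathrm{St}\otimes\chi_0$ with $\chi_0$ a character of $F^\times$ trivial on $\mathcal O^\times$, where $\mathrm{St}$ is the space of locally constant functions on $\mathbb P^1(F)$ modulo constants). Let $\Omega$ be a continuous character of $E^\times$ such that $\Omega|_{F^\times}\cdot w_\pi=1$, where $w_\pi$ is the central character of $\pi$. Assume that $\pi$ and $\Omega$ are unitary up to a common twist, that is, there are a continuous character $\chi$ of $F^\times$ and an inner product $\langle\cdot,\cdot\rangle$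 on the space of $\pi$ such that $\langle\cdot,\cdot\rangle$ is invariant under $\pi\otimes\chi$ and such that $\Omega\cdot(\chi\circ N_{E/F})^{-1}$ is unitary. Let $\varphi^0$ be a newform of $\pi$: a nonzero vector fixed by $K_1(\mathfrak p^{c})=\left\{k\in\mathrm{GL}_2(\mathcal O): k\equiv\begin{pmatrix}*&*\\0&1\end{pmatrix}\bmod \mathfrak p^{c}\right\}$, where $c\ge 0$ is the least exponent for which such vectors exist. For $n\ge 0$ put $\varphi_n=\pi\left(\begin{pmatrix}\varpi^{-n}&0\\0&1\end{pmatrix}\right)\varphi^0$, and let $\Phi_n(g)=\langle\pi(g)\varphi_n,\varphi_n\rangle/\langle\varphi_n,\varphi_n\rangle$ be its normalized matrix coefficient. Then for every $n$ the function $\Phi_n\Omega$ is integrable on $F^\times\backslash E^\times$, and there exists $\delta>0$ such that $$I(\Phi_n,\Omega)=\int_{F^\times\backslash E^\times}\Phi_n(e)\,\Omega(e)\,de=O\left(q^{-\delta n}\right)\qquad(n\to\infty).$$ -/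

import Mathlib

open scoped ValuativeRel
open Asymptotics Filter MeasureTheory

namespace LocalWaldspurger

section Group

variable (F : Type*) [Field F]

/-- The group `GL₂(F)`; over a topological field it carries the usual topology. -/
abbrev GL2 : Type _ := Matrix.GeneralLinearGroup (Fin 2) F

variable {F}

/-- The diagonal matrix `diag(a, 1)`. -/
def diagOne (a : Fˣ) : GL2 F where
  val := !![(a : F), 0; 0, 1]
  inv := !![((a⁻¹ : Fˣ) : F), 0; 0, 1]
  val_inv := by ext i j; fin_cases i <;> fin_cases j <;> simp
  inv_val := by ext i j; fin_cases i <;> fin_cases j <;> simp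

/-- The embedding of the quadratic algebra `E = F[√D]` (with `√D * √D = D`; a field if `D` is not a
square, isomorphic to `F × F` if `D` is a nonzero square and `2 ≠ 0`) into the `2 × 2` matrices,
`a + b √D ↦ (a, b; b D, a)`. -/
noncomputable def quadEmbedding (D : F) :
    QuadraticAlgebra F D 0 →ₐ[F] Matrix (Fin 2) (Fin 2) F :=
  QuadraticAlgebra.lift ⟨!![0, 1; D, 0], by
    ext i j; fin_cases i <;> fin_cases j <;> simp [Matrix.mul_apply]⟩

theorem quadEmbedding_apply (D : F) (z : QuadraticAlgebra F D 0) :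
    quadEmbedding D z = !![z.re, z.im; z.im * D, z.re] := by
  ext i j
  fin_cases i <;> fin_cases j <;> simp [quadEmbedding]

/-- The torus `E^×`, as a subgroup of `GL₂(F)` through the embedding above. -/
noncomputable def torus (D : F) : Subgroup (GL2 F) :=
  (Units.map (quadEmbedding D : QuadraticAlgebra F D 0 →* Matrix (Fin 2) (Fin 2) F)).range

/-- `E^×` consists of the invertible matrices of the form `(a, b; b D, a)`. -/
theorem mem_torus_iff (D : F) (g : GL2 F) :
    g ∈ torus D ↔ ∃ a b : F, (g : Matrix (Fin 2) (Fin 2) F) = !![a, b; b * D, a] := by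
  constructor
  · rintro ⟨z, rfl⟩
    exact ⟨(z : QuadraticAlgebra F D 0).re, (z : QuadraticAlgebra F D 0).im,
      quadEmbedding_apply D z⟩
  · rintro ⟨a, b, h⟩
    have hN : IsUnit (⟨a, b⟩ : QuadraticAlgebra F D 0) := by
      rw [QuadraticAlgebra.isUnit_iff_norm_isUnit]
      have h1 : IsUnit (g : Matrix (Fin 2) (Fin 2) F).det :=
        (Matrix.isUnit_iff_isUnit_det _).1 g.isUnit
      rw [h, Matrix.det_fin_two_of] at h1
      rw [QuadraticAlgebra.norm_def]
      convert h1 using 1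
      ring
    refine ⟨hN.unit, Units.ext ?_⟩
    rw [h]
    exact quadEmbedding_apply D _

/-- The subgroup `F^×` of `E^×` (the scalar matrices, i.e. the center of `GL₂(F)`). -/
noncomputable abbrev scalarsInTorus (D : F) : Subgroup (torus D) :=
  (Subgroup.center (GL2 F)).subgroupOf (torus D)

/-- The quotient group `F^× \ E^×`. -/
abbrev TorusModScalars (D : F) : Type _ := torus D ⧸ scalarsInTorus D

end Group

section Representations

variable {F : Type*} [Field F] {V : Type*}

section Algebraic

variable [AddCommGroup V] [Module ℂ V]

/-- The twist `π ⊗ χ`, i.e. `g ↦ χ(det g) π(g)`. -/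
noncomputable def twist (χ : Fˣ →* ℂˣ) (π : Representation ℂ (GL2 F) V) :
    Representation ℂ (GL2 F) V where
  toFun g := (χ (Matrix.GeneralLinearGroup.det g) : ℂ) • π g
  map_one' := by simp
  map_mul' g h := by
    rw [map_mul, map_mul, map_mul, Units.val_mul, smul_mul_smul_comm]

/-- `π` is admissible: every vector has an open stabilizer (`π` is smooth), and the vectors fixed by
any given open subgroup form a finite-dimensional space. -/
def IsAdmissible [TopologicalSpace F] (π : Representation ℂ (GL2 F) V) : Prop :=
  (∀ v : V, ∃ U : Subgroup (GL2 F), IsOpen (U : Set (GL2 F)) ∧ ∀ g ∈ U, π g v = v) ∧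
    ∀ U : Subgroup (GL2 F), IsOpen (U : Set (GL2 F)) →
      ∃ W : Submodule ℂ V, FiniteDimensional ℂ W ∧ ∀ v : V, (∀ g ∈ U, π g v = v) → v ∈ W

variable [ValuativeRel F] [TopologicalSpace F] [IsNonarchimedeanLocalField F]

/-- `v` is fixed by `K₁(𝔭^c)`, the group of the matrices in `GL₂(𝒪)` whose lower row is congruent to
`(0, 1)` modulo `𝔭^c`; for `c = 0` this is `GL₂(𝒪)`. -/
def IsFixedByK1 (π : Representation ℂ (GL2 F) V) (c : ℕ) (v : V) : Prop :=
  ∀ k : Matrix.GeneralLinearGroup (Fin 2) 𝒪[F],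
    k 1 0 ∈ 𝓂[F] ^ c → k 1 1 - 1 ∈ 𝓂[F] ^ c →
      π (Matrix.GeneralLinearGroup.map (algebraMap 𝒪[F] F) k) v = v

/-- `v` is a newform of `π`: a nonzero vector fixed by `K₁(𝔭^c)`, where `c` is the conductor exponent
of `π`, i.e. the least `c` for which such vectors exist. -/
def IsNewform (π : Representation ℂ (GL2 F) V) (v : V) : Prop :=
  v ≠ 0 ∧ ∃ c : ℕ, IsFixedByK1 π c v ∧ ∀ c' < c, ∀ w : V, IsFixedByK1 π c' w → w = 0

/-- `π` is unramified (spherical): it has a nonzero `GL₂(𝒪)`-fixed vector. -/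
def IsUnramifiedRep (π : Representation ℂ (GL2 F) V) : Prop :=
  ∃ v : V, v ≠ 0 ∧
    ∀ k : Matrix.GeneralLinearGroup (Fin 2) 𝒪[F],
      π (Matrix.GeneralLinearGroup.map (algebraMap 𝒪[F] F) k) v = v

end Algebraic

section Steinberg

variable (F) [TopologicalSpace F]

/-- The functions on `GL₂(F)` that are left invariant under the upper triangular Borel subgroup `B`
and right invariant under some open subgroup, i.e. the locally constant functions
on `B \ GL₂(F) = ℙ¹(F)`. -/
def flagFunctions : Submodule ℂ (GL2 F → ℂ) where
  carrier := {f | (∀ b g : GL2 F, b 1 0 = 0 → f (b * g) = f g) ∧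
    ∃ U : Subgroup (GL2 F), IsOpen (U : Set (GL2 F)) ∧ ∀ u ∈ U, ∀ g, f (g * u) = f g}
  zero_mem' := ⟨fun _ _ _ => rfl, ⊤, isOpen_univ, fun _ _ _ => rfl⟩
  add_mem' := by
    rintro f f' ⟨hf, U, hU, hfU⟩ ⟨hf', U', hU', hfU'⟩
    refine ⟨fun b g hb => ?_, U ⊓ U', hU.inter hU', fun u hu g => ?_⟩
    · simp only [Pi.add_apply, hf b g hb, hf' b g hb]
    · simp only [Pi.add_apply, hfU u hu.1 g, hfU' u hu.2 g]
  smul_mem' := by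
    rintro c f ⟨hf, U, hU, hfU⟩
    refine ⟨fun b g hb => ?_, U, hU, fun u hu g => ?_⟩
    · simp only [Pi.smul_apply, hf b g hb]
    · simp only [Pi.smul_apply, hfU u hu g]

/-- The action of `GL₂(F)` on the locally constant functions on `B \ GL₂(F)` by right translation,
`(g f)(x) = f(x g)`. -/
def flagRep [IsTopologicalRing F] : Representation ℂ (GL2 F) (flagFunctions F) where
  toFun g :=
    { toFun := fun f => ⟨fun x => (f : GL2 F → ℂ) (x * g), by
        obtain ⟨f, hf, U, hU, hfU⟩ := f
        refine ⟨fun b x hb => by simp only [mul_assoc, hf b _ hb],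
          U.comap (MulAut.conj g⁻¹).toMonoidHom, ?_, fun u hu x => ?_⟩
        · refine hU.preimage ?_
          change Continuous fun x : GL2 F => g⁻¹ * x * g⁻¹⁻¹
          fun_prop
        · have h := hfU _ hu (x * g)
          simpa [mul_assoc] using h⟩
      map_add' := fun _ _ => rfl
      map_smul' := fun _ _ => rfl }
  map_one' := by ext f x; simp
  map_mul' g h := by ext f x; simp [mul_assoc]

/-- The line of the constant functions. -/
def constFunctions : Submodule ℂ (flagFunctions F) where
  carrier := {f | ∃ c : ℂ, ∀ x, (f : GL2 F → ℂ) x = c}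
  zero_mem' := ⟨0, fun _ => rfl⟩
  add_mem' := by
    rintro f f' ⟨c, hc⟩ ⟨c', hc'⟩
    exact ⟨c + c', fun x => by simp [hc x, hc' x]⟩
  smul_mem' := by
    rintro a f ⟨c, hc⟩
    exact ⟨a * c, fun x => by simp [hc x]⟩

/-- The Steinberg (special) representation: the locally constant functions on `ℙ¹(F)` modulo the
constants. -/
def steinberg [IsTopologicalRing F] :
    Representation ℂ (GL2 F) (flagFunctions F ⧸ constFunctions F) :=
  (flagRep F).quotient (constFunctions F) (by
    rintro g f ⟨c, hc⟩
    exact ⟨c, fun x => hc (x * g)⟩)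

variable {F} [AddCommGroup V] [Module ℂ V] [ValuativeRel F] [IsNonarchimedeanLocalField F]

/-- `π` is special unramified: isomorphic to `St ⊗ χ` for a character `χ` of `F^×` that is trivial
on `𝒪^×`. -/
def IsUnramifiedSpecialRep (π : Representation ℂ (GL2 F) V) : Prop :=
  ∃ χ : Fˣ →* ℂˣ, (∀ u : Fˣ, ValuativeRel.valuation F (u : F) = 1 → χ u = 1) ∧
    Nonempty (Representation.Equiv π (twist χ (steinberg F)))

end Steinberg

section MatrixCoefficients

variable [NormedAddCommGroup V] [InnerProductSpace ℂ V]

/-- The given inner product on `V` is invariant under `π`. -/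
def IsUnitaryRep (π : Representation ℂ (GL2 F) V) : Prop :=
  ∀ (g : GL2 F) (v w : V), inner ℂ (π g v) (π g w) = inner ℂ v w

/-- The matrix coefficient `Φ(g) = ⟨π(g) v, v⟩ / ⟨v, v⟩`, normalized by `Φ(1) = 1`
(Mathlib's inner product is linear in the second variable). -/
noncomputable def matrixCoeff (π : Representation ℂ (GL2 F) V) (v : V) (g : GL2 F) : ℂ :=
  inner ℂ v (π g v) / inner ℂ v v

/-- The function on `F^× \ E^×` induced by `e ↦ Φ(e) Ω(e)`; it does not depend on the choice of
representatives when `Ω|_{F^×}` is inverse to the central character of `π`. -/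
noncomputable def localIntegrand {D : F} (π : Representation ℂ (GL2 F) V) (v : V)
    (Ω : torus D →* ℂˣ) (x : TorusModScalars D) : ℂ :=
  matrixCoeff π v (Quotient.out x : torus D) * (Ω (Quotient.out x) : ℂ)

theorem localIntegrand_mk {D : F} (π : Representation ℂ (GL2 F) V) (v : V) (Ω : torus D →* ℂˣ)
    (hΩ : ∀ z : torus D, z ∈ scalarsInTorus D → ∀ w : V, (Ω z : ℂ) • π z w = w) (e : torus D) :
    localIntegrand π v Ω (QuotientGroup.mk e) = matrixCoeff π v e * (Ω e : ℂ) := by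
  obtain ⟨z, hz⟩ := QuotientGroup.mk_out_eq_mul (scalarsInTorus D) e
  have h := hΩ z z.2 v
  have hout : (Quotient.out (QuotientGroup.mk e : TorusModScalars D)) = e * (z : torus D) := hz
  unfold localIntegrand matrixCoeff
  rw [hout]
  have h2 : (Ω (z : torus D) : ℂ) • π ((e * (z : torus D) : torus D) : GL2 F) v = π e v := by
    rw [Subgroup.coe_mul, map_mul, Module.End.mul_apply, ← map_smul, h]
  rw [← h2, inner_smul_right, map_mul, Units.val_mul]
  ring

/-- The local integral `I(Φ, Ω) = ∫_{F^× \ E^×} Φ(e) Ω(e) de`. -/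
noncomputable def localIntegral {D : F} [MeasurableSpace (TorusModScalars D)]
    (μ : Measure (TorusModScalars D)) (π : Representation ℂ (GL2 F) V) (v : V)
    (Ω : torus D →* ℂˣ) : ℂ :=
  ∫ x, localIntegrand π v Ω x ∂μ

end MatrixCoefficients

end Representations

end LocalWaldspurger

open LocalWaldspurger

/-! Replace `π` by its twist `σ` by `|χ|`, which is unitary; then `|Φ_n(e) Ω(e)|` is `|⟨φ, σ(h⁻¹ e
h) φ⟩| / ‖φ‖²` with `h = diag(ϖ⁻ⁿ, 1)`. For `e = a + b√D` the matrix `h⁻¹ e h` has determinant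
`N(e)` and lower-left entry `ϖ⁻ⁿ b D`. Everything therefore rests on a decay estimate in terms of
entries, `|⟨φ, σ(g) φ⟩| ≤ C (|det g| / |g i j|²) ^ s` for all small `s > 0`
(`exists_norm_inner_le_rpow`). It bounds the integrand by a constant times `|ϖ| ^ (2ns) · (|N(e)| /
|b|²) ^ s`: the first factor is the required saving, the second does not involve `n`, and it is
integrable for small `s` (`exists_lintegral_quotientRatio_lt_top`).

Decay. By the Cartan decomposition it suffices to treat `diag(ϖ, 1)^m` between vectors fixed by a
principal congruence subgroup `K`. On the finite-dimensional space of such vectors let `T` be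
`σ(diag(ϖ, 1))` followed by orthogonal projection. The Iwahori factorization shows that `T^m`
computes the coefficient at `diag(ϖ, 1)^m`. Since `T` is a contraction, an eigenvalue of modulus `1`
would come from a true eigenvector of `σ(diag(ϖ, 1))`. By Mautner's argument that vector is fixed by
all unipotents, hence by `SL₂(F)`, and irreducibility then forces `V` to be finite-dimensional. So
the spectral radius of `T` is less than `1`.

Integrability. The function `|b|² / |N(e)|` on `F^× \ E^×` is proper. Its small sublevel sets are
subgroups whose measure at least halves at each step, and its annuli have bounded measure at
infinity. Small negative powers are thus dominated by geometric series, with no distinction between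
`E` a field and `E` split. -/

namespace LocalWaldspurger

/-! ### The ultrametric absolute value of `F` -/

section AbsoluteValue

variable (F : Type*) [Field F] [ValuativeRel F] [TopologicalSpace F] [IsNonarchimedeanLocalField F]

/-- The absolute value of a nonarchimedean local field, normalized to be `1 / 2` at a uniformizer. -/
noncomputable def vabs : F →*₀ ℝ where
  toFun x := (WithZeroMulInt.toNNReal (e := 2) two_ne_zero
    (IsNonarchimedeanLocalField.valueGroupWithZeroIsoInt F (ValuativeRel.valuation F x)) : NNReal)
  map_zero' := by simp
  map_one' := by simp
  map_mul' x y := by simp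

variable {F}

theorem vabs_nonneg (x : F) : 0 ≤ vabs F x := NNReal.coe_nonneg _

theorem vabs_le_vabs {x y : F} :
    vabs F x ≤ vabs F y ↔ ValuativeRel.valuation F x ≤ ValuativeRel.valuation F y := by
  change ((WithZeroMulInt.toNNReal (e := 2) two_ne_zero
    (IsNonarchimedeanLocalField.valueGroupWithZeroIsoInt F _) : NNReal) : ℝ) ≤
    ((WithZeroMulInt.toNNReal (e := 2) two_ne_zero
    (IsNonarchimedeanLocalField.valueGroupWithZeroIsoInt F _) : NNReal) : ℝ) ↔ _
  rw [NNReal.coe_le_coe, (WithZeroMulInt.toNNReal_strictMono one_lt_two).le_iff_le,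
    (IsNonarchimedeanLocalField.valueGroupWithZeroIsoInt F).strictMono.le_iff_le]

theorem vabs_lt_vabs {x y : F} :
    vabs F x < vabs F y ↔ ValuativeRel.valuation F x < ValuativeRel.valuation F y := by
  rw [← not_le, vabs_le_vabs, not_le]

theorem vabs_le_one_iff {x : F} : vabs F x ≤ 1 ↔ x ∈ 𝒪[F] := by
  rw [← map_one (vabs F), vabs_le_vabs, map_one]
  rfl

theorem vabs_pos {x : F} (hx : x ≠ 0) : 0 < vabs F x :=
  lt_of_le_of_ne (vabs_nonneg x) fun h => hx ((map_eq_zero (vabs F)).1 h.symm)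

@[simp] theorem vabs_neg (x : F) : vabs F (-x) = vabs F x :=
  le_antisymm (vabs_le_vabs.2 (Valuation.map_neg _ _).le)
    (vabs_le_vabs.2 (Valuation.map_neg _ _).ge)

theorem vabs_add_le_max (x y : F) : vabs F (x + y) ≤ max (vabs F x) (vabs F y) := by
  rcases le_total (ValuativeRel.valuation F x) (ValuativeRel.valuation F y) with h | h
  · rw [max_eq_right (vabs_le_vabs.2 h), vabs_le_vabs]
    exact (Valuation.map_add _ _ _).trans (max_eq_right h).le
  · rw [max_eq_left (vabs_le_vabs.2 h), vabs_le_vabs]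
    exact (Valuation.map_add _ _ _).trans (max_eq_left h).le

theorem vabs_add_le {x y : F} {r : ℝ} (hx : vabs F x ≤ r) (hy : vabs F y ≤ r) :
    vabs F (x + y) ≤ r :=
  (vabs_add_le_max x y).trans (max_le hx hy)

theorem vabs_sub_le {x y : F} {r : ℝ} (hx : vabs F x ≤ r) (hy : vabs F y ≤ r) :
    vabs F (x - y) ≤ r := by
  rw [sub_eq_add_neg]
  exact vabs_add_le hx (by rwa [vabs_neg])

theorem vabs_add_eq_left {x y : F} (h : vabs F y < vabs F x) : vabs F (x + y) = vabs F x := by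
  refine le_antisymm ((vabs_add_le_max x y).trans (max_eq_left h.le).le) ?_
  by_contra! h'
  have h2 := vabs_add_le_max (x + y) (-y)
  rw [vabs_neg, add_neg_cancel_right] at h2
  exact absurd h2 (not_le.2 (max_lt h' h))

theorem vabs_sub_eq_left {x y : F} (h : vabs F y < vabs F x) : vabs F (x - y) = vabs F x := by
  rw [sub_eq_add_neg]
  exact vabs_add_eq_left (by rwa [vabs_neg])

theorem exists_zpow_mul_of_irreducible {x : 𝒪[F]} (hx : Irreducible x) {y : F} (hy : y ≠ 0) :
    ∃ k : ℤ, ∃ u : F, vabs F u = 1 ∧ y = u * (x : F) ^ k := by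
  have key : ∀ z : F, z ≠ 0 → vabs F z ≤ 1 →
      ∃ k : ℕ, ∃ u : F, vabs F u = 1 ∧ z = u * (x : F) ^ k := by
    intro z hz hz1
    obtain ⟨n, u, hu⟩ := IsDiscreteValuationRing.eq_unit_mul_pow_irreducible
      (x := (⟨z, vabs_le_one_iff.1 hz1⟩ : 𝒪[F])) (by
        intro h
        exact hz (congrArg Subtype.val h)) hx
    refine ⟨n, ((u : 𝒪[F]) : F), ?_, congrArg Subtype.val hu⟩
    refine le_antisymm (vabs_le_one_iff.2 (u : 𝒪[F]).2) ?_
    have h1 : vabs F (((u⁻¹ : 𝒪[F]ˣ) : 𝒪[F]) : F) ≤ 1 := vabs_le_one_iff.2 (Subtype.mem _)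
    have h2 : (((u⁻¹ : 𝒪[F]ˣ) : 𝒪[F]) : F) * ((u : 𝒪[F]) : F) = 1 := by
      rw [← MulMemClass.coe_mul, Units.inv_mul]
      rfl
    have h3 : vabs F (((u⁻¹ : 𝒪[F]ˣ) : 𝒪[F]) : F) * vabs F ((u : 𝒪[F]) : F) = 1 := by
      rw [← map_mul, h2, map_one]
    nlinarith [vabs_nonneg ((u : 𝒪[F]) : F)]
  rcases le_or_gt (vabs F y) 1 with h | h
  · obtain ⟨k, u, hu, e⟩ := key y hy h
    exact ⟨k, u, hu, by simpa using e⟩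
  · obtain ⟨k, u, hu, e⟩ := key y⁻¹ (inv_ne_zero hy) (by
      rw [map_inv₀]; exact inv_le_one_of_one_le₀ h.le)
    refine ⟨-k, u⁻¹, by rw [map_inv₀, hu, inv_one], ?_⟩
    rw [← inv_inv y, e, mul_inv, zpow_neg, zpow_natCast]

theorem vabs_irreducible {x : 𝒪[F]} (hx : Irreducible x) :
    0 < vabs F (x : F) ∧ vabs F (x : F) < 1 := by
  have h0 : (x : F) ≠ 0 := fun h => hx.ne_zero (Subtype.ext h)
  refine ⟨vabs_pos h0, lt_of_le_of_ne (vabs_le_one_iff.2 x.2) fun h => hx.not_isUnit ?_⟩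
  refine IsUnit.of_mul_eq_one ⟨(x : F)⁻¹, vabs_le_one_iff.1 ?_⟩ (Subtype.ext ?_)
  · rw [map_inv₀, h, inv_one]
  · exact mul_inv_cancel₀ h0

theorem vabs_lt_mem_nhds_zero {r : ℝ} (hr : 0 < r) : {x : F | vabs F x < r} ∈ nhds (0 : F) := by
  obtain ⟨p, hp⟩ := IsDiscreteValuationRing.exists_irreducible 𝒪[F]
  obtain ⟨h0, h1⟩ := vabs_irreducible hp
  obtain ⟨n, hn⟩ := exists_pow_lt_of_lt_one hr h1
  refine mem_of_superset ((IsValuativeTopology.hasBasis_nhds_zero' F).mem_of_mem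
    (i := ValuativeRel.valuation F ((p : F) ^ n)) ?_) ?_
  · rw [Ne, map_eq_zero]
    exact pow_ne_zero _ fun h => hp.ne_zero (Subtype.ext h)
  · intro x hx
    have := vabs_lt_vabs.2 hx
    rw [map_pow] at this
    exact this.trans hn

theorem exists_vabs_ball_subset {s : Set F} (hs : s ∈ nhds (0 : F)) :
    ∃ r : ℝ, 0 < r ∧ ∀ x : F, vabs F x < r → x ∈ s := by
  obtain ⟨γ, hγ, h⟩ := (IsValuativeTopology.hasBasis_nhds_zero' F).mem_iff.1 hs
  obtain ⟨y, rfl⟩ := ValuativeRel.valuation_surjective γ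
  rw [Ne, map_eq_zero] at hγ
  exact ⟨vabs F y, vabs_pos hγ, fun x hx => h (vabs_lt_vabs.1 hx)⟩

theorem eventually_vabs_sub_lt (x : F) {r : ℝ} (hr : 0 < r) :
    ∀ᶠ y in nhds x, vabs F (y - x) < r := by
  have h : Tendsto (fun y : F => y - x) (nhds x) (nhds 0) := by
    have : Continuous fun y : F => y - x := by fun_prop
    simpa using this.tendsto x
  exact h (vabs_lt_mem_nhds_zero hr)

theorem continuous_vabs : Continuous (vabs F) := by
  rw [continuous_iff_continuousAt]
  intro x
  by_cases hx : x = 0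
  · subst hx
    rw [ContinuousAt, map_zero, Metric.tendsto_nhds]
    intro ε hε
    filter_upwards [vabs_lt_mem_nhds_zero (F := F) hε] with y hy
    rw [dist_zero_right, Real.norm_of_nonneg (vabs_nonneg y)]
    exact hy
  · refine (continuousAt_const (y := vabs F x)).congr ?_
    filter_upwards [eventually_vabs_sub_lt x (vabs_pos hx)] with y hy
    rw [← vabs_add_eq_left hy]
    congr 1
    ring

theorem isCompact_vabs_le_one : IsCompact {x : F | vabs F x ≤ 1} := by
  have h : {x : F | vabs F x ≤ 1} = {x | ValuativeRel.valuation F x ≤ 1} := by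
    ext x
    exact vabs_le_one_iff
  rw [h]
  exact IsNonarchimedeanLocalField.isCompact_closedBall F 1

end AbsoluteValue

/-! ### Principal congruence subgroups -/

section Congruence

variable {F : Type*} [Field F] [ValuativeRel F] [TopologicalSpace F] [IsNonarchimedeanLocalField F]

theorem vabs_mul_apply_le {A B : Matrix (Fin 2) (Fin 2) F} {r s : ℝ}
    (hA : ∀ i j, vabs F (A i j) ≤ r) (hB : ∀ i j, vabs F (B i j) ≤ s) (i j : Fin 2) :
    vabs F ((A * B) i j) ≤ r * s := by
  have hr : 0 ≤ r := (vabs_nonneg _).trans (hA 0 0)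
  rw [Matrix.mul_apply, Fin.sum_univ_two]
  refine vabs_add_le ?_ ?_ <;> rw [map_mul] <;>
    exact mul_le_mul (hA _ _) (hB _ _) (vabs_nonneg _) hr

theorem vabs_one_apply_le (i j : Fin 2) : vabs F ((1 : Matrix (Fin 2) (Fin 2) F) i j) ≤ 1 := by
  rw [Matrix.one_apply]
  split_ifs <;> simp

/-- A matrix congruent to `1` modulo an ideal of `𝒪` is integral. -/
theorem vabs_apply_le_one {A : Matrix (Fin 2) (Fin 2) F} {r : ℝ} (hr : r ≤ 1)
    (hA : ∀ i j, vabs F ((A - 1) i j) ≤ r) (i j : Fin 2) : vabs F (A i j) ≤ 1 := by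
  have h : A i j = (A - 1) i j + (1 : Matrix (Fin 2) (Fin 2) F) i j := by simp
  rw [h]
  exact vabs_add_le ((hA i j).trans hr) (vabs_one_apply_le i j)

theorem vabs_inv_apply_le_one {g : GL2 F} (hg : ∀ i j, vabs F (g i j) ≤ 1)
    (hdet : vabs F (g : Matrix (Fin 2) (Fin 2) F).det = 1) (i j : Fin 2) :
    vabs F ((g⁻¹ : GL2 F) i j) ≤ 1 := by
  rw [Matrix.coe_units_inv, Matrix.inv_def, Matrix.smul_apply, smul_eq_mul, map_mul,
    Ring.inverse_eq_inv', map_inv₀, hdet, inv_one, one_mul, Matrix.adjugate_fin_two]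
  fin_cases i <;> fin_cases j <;> simp [hg]

/-- The subgroup of the matrices in `GL₂(𝒪)` that are congruent to `1` modulo the ideal of the
elements of absolute value at most `r` (for `r = 1`, this is `GL₂(𝒪)`). -/
def congruence (r : ℝ) (hr0 : 0 < r) (hr1 : r ≤ 1) : Subgroup (GL2 F) where
  carrier := {g | (∀ i j, vabs F (((g : Matrix (Fin 2) (Fin 2) F) - 1) i j) ≤ r) ∧
    vabs F (g : Matrix (Fin 2) (Fin 2) F).det = 1}
  one_mem' := ⟨fun i j => by simp [hr0.le], by simp⟩
  mul_mem' := by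
    rintro g h ⟨hg, hgd⟩ ⟨hh, hhd⟩
    refine ⟨fun i j => ?_, by simp [hgd, hhd]⟩
    have e : ((g * h : GL2 F) : Matrix (Fin 2) (Fin 2) F) - 1 =
        (g : Matrix (Fin 2) (Fin 2) F) * ((h : Matrix (Fin 2) (Fin 2) F) - 1) +
          ((g : Matrix (Fin 2) (Fin 2) F) - 1) := by
      rw [Units.val_mul]; noncomm_ring
    rw [e, Matrix.add_apply]
    refine vabs_add_le ?_ (hg i j)
    simpa using vabs_mul_apply_le (vabs_apply_le_one hr1 hg) hh i j
  inv_mem' := by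
    rintro g ⟨hg, hgd⟩
    refine ⟨fun i j => ?_, ?_⟩
    · have e : ((g⁻¹ : GL2 F) : Matrix (Fin 2) (Fin 2) F) - 1 =
          ((g⁻¹ : GL2 F) : Matrix (Fin 2) (Fin 2) F) *
            -((g : Matrix (Fin 2) (Fin 2) F) - 1) := by
        have : ((g⁻¹ : GL2 F) : Matrix (Fin 2) (Fin 2) F) * (g : Matrix (Fin 2) (Fin 2) F) = 1 :=
          Units.inv_mul g
        rw [neg_sub, mul_sub, this, mul_one]
      rw [e]
      have h := vabs_mul_apply_le (s := r)
        (vabs_inv_apply_le_one (vabs_apply_le_one hr1 hg) hgd)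
        (B := -((g : Matrix (Fin 2) (Fin 2) F) - 1)) (fun i j => by
          rw [Matrix.neg_apply, vabs_neg]; exact hg i j) i j
      simpa using h
    · have h1 : ((g⁻¹ : GL2 F) : Matrix (Fin 2) (Fin 2) F).det *
          (g : Matrix (Fin 2) (Fin 2) F).det = 1 := by
        rw [← Matrix.det_mul, ← Units.val_mul, inv_mul_cancel, Units.val_one, Matrix.det_one]
      have h2 := congrArg (vabs F) h1
      rwa [map_mul, hgd, mul_one, map_one] at h2

theorem congruence_mono {r s : ℝ} {hr0 : 0 < r} {hr1 : r ≤ 1} {hs0 : 0 < s} {hs1 : s ≤ 1}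
    (h : r ≤ s) : congruence (F := F) r hr0 hr1 ≤ congruence s hs0 hs1 :=
  fun _ hg => ⟨fun i j => (hg.1 i j).trans h, hg.2⟩

theorem mem_congruence_one {g : GL2 F} :
    g ∈ congruence (F := F) 1 one_pos le_rfl ↔ (∀ i j, vabs F (g i j) ≤ 1) ∧
      vabs F (g : Matrix (Fin 2) (Fin 2) F).det = 1 := by
  refine ⟨fun h => ⟨vabs_apply_le_one le_rfl h.1, h.2⟩, fun h => ⟨fun i j => ?_, h.2⟩⟩
  rw [Matrix.sub_apply]
  exact vabs_sub_le (h.1 i j) (vabs_one_apply_le i j)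

/-- `GL₂(𝒪)` normalizes the principal congruence subgroups. -/
theorem conj_mem_congruence {r : ℝ} {hr0 : 0 < r} {hr1 : r ≤ 1} {k g : GL2 F}
    (hk : k ∈ congruence (F := F) 1 one_pos le_rfl) (hg : g ∈ congruence r hr0 hr1) :
    k⁻¹ * g * k ∈ congruence r hr0 hr1 := by
  have hk' := mem_congruence_one.1 (inv_mem hk)
  have hk1 := mem_congruence_one.1 hk
  refine ⟨fun i j => ?_, ?_⟩
  · have e : ((k⁻¹ * g * k : GL2 F) : Matrix (Fin 2) (Fin 2) F) - 1 =
        ((k⁻¹ : GL2 F) : Matrix (Fin 2) (Fin 2) F) *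
          ((g : Matrix (Fin 2) (Fin 2) F) - 1) * (k : Matrix (Fin 2) (Fin 2) F) := by
      have : ((k⁻¹ : GL2 F) : Matrix (Fin 2) (Fin 2) F) * (k : Matrix (Fin 2) (Fin 2) F) = 1 :=
        Units.inv_mul k
      rw [Units.val_mul, Units.val_mul, mul_sub, sub_mul, mul_one, this]
    rw [e]
    simpa using vabs_mul_apply_le (vabs_mul_apply_le hk'.1 hg.1) hk1.1 i j
  · rw [Units.val_mul, Units.val_mul, Matrix.det_mul, Matrix.det_mul, map_mul, map_mul, hk'.2,
      hk1.2, hg.2]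
    norm_num

theorem isOpen_congruence {r : ℝ} {hr0 : 0 < r} {hr1 : r ≤ 1} :
    IsOpen (congruence (F := F) r hr0 hr1 : Set (GL2 F)) := by
  refine Subgroup.isOpen_of_mem_nhds _ (g := 1) ?_
  have hc : Continuous fun g : GL2 F => (g : Matrix (Fin 2) (Fin 2) F) := Units.continuous_val
  have hdet : Continuous fun g : GL2 F => (g : Matrix (Fin 2) (Fin 2) F).det :=
    Continuous.matrix_det hc
  have h1 : ∀ i j : Fin 2, ∀ᶠ g : GL2 F in nhds 1,
      vabs F (((g : Matrix (Fin 2) (Fin 2) F) - 1) i j) < r := by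
    intro i j
    have h : Continuous fun g : GL2 F => vabs F (((g : Matrix (Fin 2) (Fin 2) F) - 1) i j) :=
      continuous_vabs.comp ((hc.sub continuous_const).matrix_elem i j)
    exact h.continuousAt.eventually_lt continuousAt_const (by simpa using hr0)
  have h2 : ∀ᶠ g : GL2 F in nhds 1, vabs F ((g : Matrix (Fin 2) (Fin 2) F).det - 1) < 1 := by
    have h : Continuous fun g : GL2 F => vabs F ((g : Matrix (Fin 2) (Fin 2) F).det - 1) :=
      continuous_vabs.comp (hdet.sub continuous_const)
    exact h.continuousAt.eventually_lt continuousAt_const (by simp)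
  filter_upwards [h1 0 0, h1 0 1, h1 1 0, h1 1 1, h2] with g h00 h01 h10 h11 hd
  refine ⟨fun i j => ?_, ?_⟩
  · fin_cases i <;> fin_cases j
    exacts [h00.le, h01.le, h10.le, h11.le]
  · have e : (g : Matrix (Fin 2) (Fin 2) F).det =
        1 + ((g : Matrix (Fin 2) (Fin 2) F).det - 1) := by ring
    rw [e, vabs_add_eq_left (by rwa [map_one]), map_one]

/-- The principal congruence subgroups form a basis of neighbourhoods of `1`. -/
theorem exists_congruence_subset {U : Set (GL2 F)} (hU : U ∈ nhds (1 : GL2 F)) :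
    ∃ (r : ℝ) (hr0 : 0 < r) (hr1 : r < 1), (congruence (F := F) r hr0 hr1.le : Set (GL2 F)) ⊆ U := by
  -- The topology of a unit group is induced by `g ↦ (g, g⁻¹)`, so both `g` and `g⁻¹` have to be
  -- close to `1`; for elements of a subgroup the second closeness follows from the first.
  rw [Units.isInducing_embedProduct.nhds_eq_comap, mem_comap] at hU
  obtain ⟨S, hS, hSU⟩ := hU
  rw [Units.embedProduct_apply, nhds_prod_eq, mem_prod_iff] at hS
  obtain ⟨S1, hS1, S2, hS2, hS⟩ := hS
  have key : ∀ S : Set (Matrix (Fin 2) (Fin 2) F), S ∈ nhds (1 : Matrix (Fin 2) (Fin 2) F) →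
      ∃ r : ℝ, 0 < r ∧ ∀ A : Matrix (Fin 2) (Fin 2) F,
        (∀ i j, vabs F ((A - 1) i j) < r) → A ∈ S := by
    intro S hS
    have hc : Tendsto (fun B : Matrix (Fin 2) (Fin 2) F => B + 1) (nhds 0) (nhds 1) := by
      have : Continuous (fun B : Matrix (Fin 2) (Fin 2) F => B + 1) := by fun_prop
      simpa using this.tendsto 0
    have h0 := hc hS
    rw [mem_map] at h0
    have h0' : {B : Fin 2 → Fin 2 → F | Matrix.of B + 1 ∈ S} ∈
      nhds (0 : Fin 2 → Fin 2 → F) := h0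
    rw [nhds_pi, mem_pi] at h0'
    obtain ⟨I, -, t, ht, hI⟩ := h0'
    have ht' : ∀ i, ∃ r : ℝ, 0 < r ∧ ∀ x : Fin 2 → F, (∀ j, vabs F (x j) < r) → x ∈ t i := by
      intro i
      have := ht i
      rw [Pi.zero_apply, nhds_pi, mem_pi] at this
      obtain ⟨J, -, u, hu, hJ⟩ := this
      choose r hr hru using fun j => exists_vabs_ball_subset (hu j)
      refine ⟨min (r 0) (r 1), lt_min (hr 0) (hr 1), fun x hx => hJ fun j _ => hru j _ ?_⟩
      refine (hx j).trans_le ?_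
      fin_cases j
      exacts [min_le_left _ _, min_le_right _ _]
    choose r hr hrt using ht'
    refine ⟨min (r 0) (r 1), lt_min (hr 0) (hr 1), fun A hA => ?_⟩
    have : (fun i j => (A - 1) i j) ∈ {B : Fin 2 → Fin 2 → F | Matrix.of B + 1 ∈ S} := by
      refine hI fun i _ => hrt i _ fun j => (hA i j).trans_le ?_
      fin_cases i
      exacts [min_le_left _ _, min_le_right _ _]
    have e : Matrix.of (fun i j => (A - 1) i j) + 1 = A := sub_add_cancel A 1
    rwa [Set.mem_ofPred_eq, e] at this
  obtain ⟨r1, hr1, h1⟩ := key S1 (by simpa using hS1)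
  obtain ⟨r2, hr2, h2⟩ := key (MulOpposite.op ⁻¹' S2) (by
    refine MulOpposite.continuous_op.continuousAt ?_
    simpa using hS2)
  -- The bound `1 / 2` ensures `r < 1`; halving turns the non-strict bounds that define the
  -- congruence subgroup into strict ones.
  have hm : 0 < min (1 / 2) (min r1 r2 / 2) := by positivity
  refine ⟨min (1 / 2) (min r1 r2 / 2), hm, (min_le_left _ _).trans_lt (by norm_num), ?_⟩
  intro g hg
  have hlt : min (1 / 2) (min r1 r2 / 2) < min r1 r2 :=
    (min_le_right _ _).trans_lt (half_lt_self (by positivity))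
  have hg' := inv_mem hg
  refine hSU (hS ⟨h1 _ fun i j => ?_, h2 _ fun i j => ?_⟩)
  · exact (hg.1 i j).trans_lt (hlt.trans_le (min_le_left _ _))
  · exact (hg'.1 i j).trans_lt (hlt.trans_le (min_le_right _ _))

end Congruence

/-! ### Fixed vectors, and averaging in unitary representations -/

section Fixed

variable {G : Type*} [Group G] {V : Type*} [AddCommGroup V] [Module ℂ V]

/-- The vectors fixed by a subgroup. -/
def fixedVectors (σ : Representation ℂ G V) (K : Subgroup G) : Submodule ℂ V where
  carrier := {v | ∀ k ∈ K, σ k v = v}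
  zero_mem' _ _ := map_zero _
  add_mem' hv hw k hk := by rw [map_add, hv k hk, hw k hk]
  smul_mem' c v hv k hk := by rw [map_smul, hv k hk]

theorem apply_mem_fixedVectors {σ : Representation ℂ G V} {K K' : Subgroup G} {v : V}
    (hv : v ∈ fixedVectors σ K) {g : G} (hg : ∀ k ∈ K', g⁻¹ * k * g ∈ K) :
    σ g v ∈ fixedVectors σ K' := by
  intro k hk
  have h : k * g = g * (g⁻¹ * k * g) := by group
  rw [← Module.End.mul_apply, ← map_mul, h, map_mul, Module.End.mul_apply, hv _ (hg k hk)]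

end Fixed

section Unitary

variable {F : Type*} [Field F] {V : Type*} [NormedAddCommGroup V] [InnerProductSpace ℂ V]
  {σ : Representation ℂ (GL2 F) V}

theorem IsUnitaryRep.norm_apply (hu : IsUnitaryRep σ) (g : GL2 F) (v : V) : ‖σ g v‖ = ‖v‖ := by
  rw [@norm_eq_sqrt_re_inner ℂ, hu, ← @norm_eq_sqrt_re_inner ℂ]

theorem IsUnitaryRep.inner_apply_right (hu : IsUnitaryRep σ) (g : GL2 F) (v w : V) :
    inner ℂ v (σ g w) = inner ℂ (σ g⁻¹ v) w := by
  rw [← hu g (σ g⁻¹ v) w, ← Module.End.mul_apply, ← map_mul, mul_inv_cancel, map_one,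
    Module.End.one_apply]

theorem IsUnitaryRep.inner_mul_apply (hu : IsUnitaryRep σ) {K : Subgroup (GL2 F)} {v w : V}
    (hv : v ∈ fixedVectors σ K) (hw : w ∈ fixedVectors σ K) {k k' : GL2 F} (hk : k ∈ K)
    (hk' : k' ∈ K) (g : GL2 F) : inner ℂ v (σ (k * g * k') w) = inner ℂ v (σ g w) := by
  rw [map_mul, Module.End.mul_apply, hw k' hk', map_mul, Module.End.mul_apply,
    hu.inner_apply_right, hv _ (inv_mem hk)]

/-- The projection to the vectors fixed by a subgroup `K`, as an average: if the `K`-translates of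
`x` span a finite-dimensional space, then `x` is congruent to a `K`-fixed vector modulo the span
of the differences `k x - x`. -/
theorem IsUnitaryRep.exists_fixed_sub_mem_span (hu : IsUnitaryRep σ) (K : Subgroup (GL2 F)) (x : V)
    (W : Submodule ℂ V) [FiniteDimensional ℂ W] (hW : ∀ k ∈ K, σ k x ∈ W) :
    ∃ p ∈ fixedVectors σ K, x - p ∈ Submodule.span ℂ ((fun k => σ k x - x) '' (K : Set (GL2 F))) := by
  set L := Submodule.span ℂ ((fun k => σ k x - x) '' (K : Set (GL2 F))) with hL
  have hLW : L ≤ W := by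
    rw [hL, Submodule.span_le]
    rintro _ ⟨k, hk, rfl⟩
    refine sub_mem (hW k hk) ?_
    simpa using hW 1 (one_mem K)
  have : FiniteDimensional ℂ L := Submodule.finiteDimensional_of_le hLW
  have hinv : ∀ k ∈ K, ∀ y ∈ L, σ k y ∈ L := by
    intro k hk y hy
    have : L ≤ L.comap (σ k) := by
      conv_lhs => rw [hL]
      rw [Submodule.span_le]
      rintro _ ⟨l, hl, rfl⟩
      change σ k (σ l x - x) ∈ L
      have e : σ k (σ l x - x) = (σ (k * l) x - x) - (σ k x - x) := by
        rw [map_sub, map_mul, Module.End.mul_apply]; abel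
      rw [e]
      exact sub_mem (Submodule.subset_span ⟨_, mul_mem hk hl, rfl⟩)
        (Submodule.subset_span ⟨_, hk, rfl⟩)
    exact this hy
  have horth : ∀ k ∈ K, ∀ y ∈ Lᗮ, σ k y ∈ Lᗮ := by
    intro k hk y hy
    rw [Submodule.mem_orthogonal] at hy ⊢
    intro u hu'
    rw [hu.inner_apply_right]
    exact hy _ (hinv _ (inv_mem hk) _ hu')
  -- Since `L` and `Lᗮ` are both `K`-stable, the difference `σ k p - p` for this `p` lies in `L ∩ Lᗮ
  -- = 0`. The projection thus replaces a Haar average over `K`.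
  refine ⟨x - L.starProjection x, fun k hk => ?_, ?_⟩
  · have h1 : x - L.starProjection x ∈ Lᗮ := L.sub_starProjection_mem_orthogonal x
    have h2 : L.starProjection x ∈ L := L.starProjection_apply_mem x
    rw [← sub_eq_zero]
    have h3 : σ k (x - L.starProjection x) - (x - L.starProjection x) ∈ Lᗮ :=
      sub_mem (horth k hk _ h1) h1
    have h4 : σ k (x - L.starProjection x) - (x - L.starProjection x) ∈ L := by
      have e : σ k (x - L.starProjection x) - (x - L.starProjection x) =
        (σ k x - x) - (σ k (L.starProjection x) - L.starProjection x) := by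
        rw [map_sub]; abel
      rw [e]
      exact sub_mem (Submodule.subset_span ⟨_, hk, rfl⟩) (sub_mem (hinv k hk _ h2) h2)
    exact inner_self_eq_zero.1 (Submodule.mem_orthogonal _ _ |>.1 h3 _ h4)
  · rw [sub_sub_cancel]
    exact L.starProjection_apply_mem x

end Unitary

/-! ### Exponential decay of powers -/

section SpectralRadius

/-- The powers of an endomorphism of a finite-dimensional complex space decay exponentially when all
the eigenvalues have absolute value less than `1`. -/
theorem exists_norm_pow_le_of_eigenvalues {W : Type*} [NormedAddCommGroup W] [NormedSpace ℂ W]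
    [FiniteDimensional ℂ W] (T : W →L[ℂ] W)
    (hT : ∀ (μ : ℂ) (w : W), w ≠ 0 → T w = μ • w → ‖μ‖ < 1) :
    ∃ C ρ : ℝ, 0 ≤ C ∧ 0 < ρ ∧ ρ < 1 ∧ ∀ m : ℕ, ‖T ^ m‖ ≤ C * ρ ^ m := by
  have : CompleteSpace W := FiniteDimensional.complete ℂ W
  rcases subsingleton_or_nontrivial W with hW | hW
  · refine ⟨0, 1 / 2, le_rfl, by norm_num, by norm_num, fun m => ?_⟩
    have : T ^ m = 0 := by ext w; exact Subsingleton.elim _ _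
    simp [this]
  -- The spectrum is compact and nonempty, so a strict bound at each of its points suffices; in
  -- finite dimension these points are eigenvalues.
  have hr : spectralRadius ℂ T < 1 := by
    refine spectrum.spectralRadius_lt_of_forall_lt T (r := 1) fun z hz => ?_
    have h1 : z ∈ spectrum ℂ (T : W →ₗ[ℂ] W) := by
      rw [spectrum.mem_iff] at hz ⊢
      refine fun h => hz ?_
      rw [ContinuousLinearMap.isUnit_iff_bijective]
      exact (Module.End.isUnit_iff _).1 h
    obtain ⟨w, hw⟩ := (Module.End.hasEigenvalue_iff_mem_spectrum.2 h1).exists_hasEigenvector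
    have := hT z w hw.2 (Module.End.mem_eigenspace_iff.1 hw.1)
    exact_mod_cast this
  obtain ⟨ρ, hρ1, hρ2⟩ := ENNReal.lt_iff_exists_nnreal_btwn.1 hr
  have hlim := (spectrum.pow_nnnorm_pow_one_div_tendsto_nhds_spectralRadius T).eventually_lt_const
    hρ1
  have hρ0 : (0 : ℝ) < ρ := by
    have : (0 : ENNReal) < ρ := bot_le.trans_lt hρ1
    exact_mod_cast this
  have hO : (fun m : ℕ => T ^ m) =O[atTop] fun m : ℕ => (ρ : ℝ) ^ m := by
    refine IsBigO.of_bound 1 ?_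
    filter_upwards [hlim, eventually_gt_atTop 0] with m hm hm0
    rw [one_mul, Real.norm_of_nonneg (by positivity)]
    have h1 : ((‖T ^ m‖₊ : ENNReal) ^ (1 / (m : ℝ))) ^ (m : ℝ) ≤ (ρ : ENNReal) ^ (m : ℝ) :=
      ENNReal.rpow_le_rpow hm.le (by positivity)
    rw [← ENNReal.rpow_mul, one_div, inv_mul_cancel₀ (by positivity), ENNReal.rpow_one,
      ENNReal.rpow_natCast] at h1
    exact_mod_cast h1
  -- Gelfand's formula only gives large `m`; as `ρ ^ m` never vanishes, enlarging the constant
  -- covers the remaining ones.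
  obtain ⟨C, hC, h⟩ := bound_of_isBigO_nat_atTop hO
  refine ⟨C, ρ, hC.le, hρ0, by exact_mod_cast hρ2, fun m => ?_⟩
  have := h (x := m) (by positivity)
  rwa [Real.norm_of_nonneg (by positivity)] at this

end SpectralRadius

/-! ### Unipotent and diagonal matrices -/

section Torus

variable {F : Type*} [Field F]

/-- The matrix `(1, x; 0, 1)`. -/
def upperUnip (x : F) : GL2 F where
  val := !![1, x; 0, 1]
  inv := !![1, -x; 0, 1]
  val_inv := by ext i j; fin_cases i <;> fin_cases j <;> simp
  inv_val := by ext i j; fin_cases i <;> fin_cases j <;> simp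

/-- The matrix `(1, 0; x, 1)`. -/
def lowerUnip (x : F) : GL2 F where
  val := !![1, 0; x, 1]
  inv := !![1, 0; -x, 1]
  val_inv := by ext i j; fin_cases i <;> fin_cases j <;> simp
  inv_val := by ext i j; fin_cases i <;> fin_cases j <;> simp

theorem diagOne_pow (a : Fˣ) (m : ℕ) : diagOne a ^ m = diagOne (a ^ m) := by
  induction m with
  | zero => ext i j; fin_cases i <;> fin_cases j <;> simp [diagOne]
  | succ m ih =>
    rw [pow_succ, ih]
    ext i j; fin_cases i <;> fin_cases j <;> simp [diagOne, pow_succ]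

theorem diagOne_mul_upperUnip (a : Fˣ) (x : F) :
    diagOne a * upperUnip x = upperUnip (a * x) * diagOne a := by
  ext i j; fin_cases i <;> fin_cases j <;> simp [diagOne, upperUnip]

theorem lowerUnip_mul_diagOne (a : Fˣ) (x : F) :
    lowerUnip x * diagOne a = diagOne a * lowerUnip (a * x) := by
  ext i j; fin_cases i <;> fin_cases j <;> simp [diagOne, lowerUnip, mul_comm]

/-- The two off-diagonal entries scale in opposite directions. For `|a| < 1` the lower-left one
shrinks, which serves the decay estimate; for `a = ϖ⁻ⁿ` it grows, which produces the saving in `n`.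
-/
theorem coe_conj_diagOne (a : Fˣ) (k : GL2 F) :
    (((diagOne a)⁻¹ * k * diagOne a : GL2 F) : Matrix (Fin 2) (Fin 2) F) =
      !![k 0 0, (a : F)⁻¹ * k 0 1; a * k 1 0, k 1 1] := by
  have h : (((diagOne a)⁻¹ : GL2 F) : Matrix (Fin 2) (Fin 2) F) = !![(a : F)⁻¹, 0; 0, 1] := by
    rw [← Units.val_inv_eq_inv_val]
    rfl
  have ha : (a : F) ≠ 0 := a.ne_zero
  rw [Units.val_mul, Units.val_mul, h, Matrix.eta_fin_two (k : Matrix (Fin 2) (Fin 2) F)]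
  ext i j; fin_cases i <;> fin_cases j <;> simp [diagOne, Matrix.mul_apply]
  · field_simp
  · ring

theorem det_conj (h k : GL2 F) : ((h⁻¹ * k * h : GL2 F) : Matrix (Fin 2) (Fin 2) F).det =
    (k : Matrix (Fin 2) (Fin 2) F).det := by
  have : Matrix.GeneralLinearGroup.det (h⁻¹ * k * h) = Matrix.GeneralLinearGroup.det k := by
    rw [map_mul, map_mul, map_inv, mul_comm, mul_inv_cancel_left]
  exact congrArg Units.val this

theorem coe_upperUnip_mul (x : F) (k : GL2 F) :
    ((upperUnip x * k : GL2 F) : Matrix (Fin 2) (Fin 2) F) =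
      !![k 0 0 + x * k 1 0, k 0 1 + x * k 1 1; k 1 0, k 1 1] := by
  rw [Units.val_mul, Matrix.eta_fin_two (k : Matrix (Fin 2) (Fin 2) F)]
  ext i j; fin_cases i <;> fin_cases j <;> simp [upperUnip, Matrix.mul_apply]

/-- `SL₂` is generated by the unipotent matrices. -/
theorem mem_of_det_eq_one {S : Subgroup (GL2 F)} (hup : ∀ x, upperUnip x ∈ S)
    (hlow : ∀ x, lowerUnip x ∈ S) {g : GL2 F}
    (hg : (g : Matrix (Fin 2) (Fin 2) F).det = 1) : g ∈ S := by
  have key : ∀ g : GL2 F, (g : Matrix (Fin 2) (Fin 2) F).det = 1 → g 1 0 ≠ 0 → g ∈ S := by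
    intro g hg hc
    have e : g = upperUnip ((g 0 0 - 1) / g 1 0) * lowerUnip (g 1 0) *
        upperUnip ((g 1 1 - 1) / g 1 0) := by
      rw [Matrix.det_fin_two] at hg
      ext i j; fin_cases i <;> fin_cases j <;> simp [upperUnip, lowerUnip] <;> field_simp
      · ring
      · linear_combination -hg
      · ring
    rw [e]
    exact mul_mem (mul_mem (hup _) (hlow _)) (hup _)
  by_cases hc : g 1 0 = 0
  · have h11 : g 1 1 ≠ 0 := by
      intro h
      rw [Matrix.det_fin_two, h, hc] at hg
      simp at hg
    -- Right multiplication by `lowerUnip 1` replaces the vanishing lower-left entry by `g 1 1 ≠ 0`.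
    have h := key (g * lowerUnip 1) (by simp [hg, lowerUnip, Matrix.det_fin_two_of])
      (by simpa [lowerUnip, Matrix.mul_apply, hc] using h11)
    exact (Subgroup.mul_mem_cancel_right S (hlow 1)).1 h
  · exact key g hg hc

end Torus

/-! ### Decay of matrix coefficients along the diagonal -/

section Decay

variable {F : Type*} [Field F] [ValuativeRel F] [TopologicalSpace F] [IsNonarchimedeanLocalField F]
  {V : Type*} [NormedAddCommGroup V] [InnerProductSpace ℂ V] {σ : Representation ℂ (GL2 F) V}

theorem upperUnip_mem_congruence {r : ℝ} {hr0 : 0 < r} {hr1 : r ≤ 1} {x : F} (hx : vabs F x ≤ r) :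
    upperUnip x ∈ congruence r hr0 hr1 := by
  refine ⟨fun i j => ?_, by simp [upperUnip, Matrix.det_fin_two_of]⟩
  fin_cases i <;> fin_cases j <;> simp [upperUnip, hr0.le, hx]

theorem lowerUnip_mem_congruence {r : ℝ} {hr0 : 0 < r} {hr1 : r ≤ 1} {x : F} (hx : vabs F x ≤ r) :
    lowerUnip x ∈ congruence r hr0 hr1 := by
  refine ⟨fun i j => ?_, by simp [lowerUnip, Matrix.det_fin_two_of]⟩
  fin_cases i <;> fin_cases j <;> simp [lowerUnip, hr0.le, hx]

theorem diagOne_mem_congruence {r : ℝ} {hr0 : 0 < r} {hr1 : r ≤ 1} {u : Fˣ}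
    (hu1 : vabs F u = 1) (hu : vabs F ((u : F) - 1) ≤ r) : diagOne u ∈ congruence r hr0 hr1 := by
  refine ⟨fun i j => ?_, by simp [diagOne, Matrix.det_fin_two_of, hu1]⟩
  fin_cases i <;> fin_cases j <;> simp [diagOne, hr0.le, hu]

/-- A consequence of the Iwahori factorization of the principal congruence subgroups. -/
theorem diagOne_pow_mul_mul_diagOne {r : ℝ} {hr0 : 0 < r} (hr1 : r < 1) {a : Fˣ}
    (ha : vabs F a ≤ 1) {k : GL2 F} (hk : k ∈ congruence r hr0 hr1.le) (m : ℕ) :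
    ∃ k' ∈ congruence (F := F) r hr0 hr1.le, ∃ k'' ∈ congruence (F := F) r hr0 hr1.le,
      diagOne a ^ m * k * diagOne a = k' * diagOne a ^ (m + 1) * k'' := by
  have h00 := hk.1 0 0
  have h01 := hk.1 0 1
  have h10 := hk.1 1 0
  have h11 := hk.1 1 1
  simp only [Matrix.sub_apply, Matrix.one_apply_eq, Matrix.one_apply_ne (one_ne_zero),
    Matrix.one_apply_ne (zero_ne_one), sub_zero] at h00 h01 h10 h11
  have hδ : vabs F (k 1 1) = 1 := by
    have e : k 1 1 = 1 + (k 1 1 - 1) := by ring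
    rw [e, vabs_add_eq_left, map_one]
    rw [map_one]
    exact h11.trans_lt hr1
  have hδ0 : k 1 1 ≠ 0 := by
    intro h
    rw [h, map_zero] at hδ
    exact zero_ne_one hδ
  -- With this `x`, `k` is `upperUnip x` times a lower triangular matrix. The upper factor passes to
  -- the left through `diagOne a ^ m` and becomes `upperUnip (a ^ m * x)`; the lower one passes to
  -- the right through `diagOne a`, its lower-left entry being multiplied by `a`. Both stay in the
  -- congruence subgroup because `|a| ≤ 1`.
  set x : F := k 0 1 / k 1 1 with hx
  have hxr : vabs F x ≤ r := by rw [hx, map_div₀, hδ, div_one]; exact h01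
  have hk0 : upperUnip (-x) * k ∈ congruence r hr0 hr1.le :=
    mul_mem (upperUnip_mem_congruence (by rwa [vabs_neg])) hk
  have hup : upperUnip x * upperUnip (-x) = 1 := by
    ext i j; fin_cases i <;> fin_cases j <;> simp [upperUnip]
  have ham : vabs F ((a ^ m : Fˣ) : F) ≤ 1 := by
    rw [Units.val_pow_eq_pow_val, map_pow]
    exact pow_le_one₀ (vabs_nonneg _) ha
  refine ⟨upperUnip (((a ^ m : Fˣ) : F) * x), upperUnip_mem_congruence ?_,
    (diagOne a)⁻¹ * (upperUnip (-x) * k) * diagOne a, ⟨fun i j => ?_, ?_⟩, ?_⟩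
  · rw [map_mul]
    nlinarith [vabs_nonneg x]
  · have h1 := hk0.1 i j
    have hz : k 0 1 + -(x * k 1 1) = 0 := by
      rw [hx]; field_simp; ring
    rw [Matrix.sub_apply, coe_upperUnip_mul] at h1
    rw [Matrix.sub_apply, coe_conj_diagOne, coe_upperUnip_mul]
    fin_cases i <;> fin_cases j
    · simpa using h1
    · simp [hz, hr0.le]
    · simp at h1 ⊢
      nlinarith [vabs_nonneg (k 1 0)]
    · simpa using h1
  · rw [det_conj]
    exact hk0.2
  · have h1 : upperUnip (((a ^ m : Fˣ) : F) * x) * diagOne a ^ m = diagOne a ^ m * upperUnip x := by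
      rw [diagOne_pow, diagOne_mul_upperUnip]
    calc diagOne a ^ m * k * diagOne a
        = diagOne a ^ m * (upperUnip x * upperUnip (-x)) * k * diagOne a := by rw [hup, mul_one]
      _ = (diagOne a ^ m * upperUnip x) * upperUnip (-x) * k * diagOne a := by
        simp only [mul_assoc]
      _ = _ := by rw [← h1, pow_succ]; group

/-- The only vectors that are fixed by a principal congruence subgroup and that are eigenvectors of
`diag(a, 1)`, where `|a| < 1`, in an infinite-dimensional irreducible admissible representation
are zero. -/
theorem eq_zero_of_diagOne_eigenvector
    (hirr : ∀ W : Submodule ℂ V, (∀ g, ∀ w ∈ W, σ g w ∈ W) → W = ⊥ ∨ W = ⊤)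
    (hinf : ¬ FiniteDimensional ℂ V) {r : ℝ} {hr0 : 0 < r} (hr1 : r < 1)
    (hfin : FiniteDimensional ℂ (fixedVectors σ (congruence r hr0 hr1.le)))
    {a : Fˣ} (ha : vabs F a < 1) {w : V} (hw : w ∈ fixedVectors σ (congruence r hr0 hr1.le))
    {c : ℂ} (hc : c ≠ 0) (hac : σ (diagOne a) w = c • w) : w = 0 := by
  have hpow : ∀ j : ℕ, σ (diagOne a ^ j) w = c ^ j • w := by
    intro j
    induction j with
    | zero => simp
    | succ j ih =>
      rw [pow_succ, map_mul, Module.End.mul_apply, hac, map_smul, ih, smul_smul, pow_succ, mul_comm]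
  have hsmall : ∀ x : F, ∃ j : ℕ, vabs F (((a ^ j : Fˣ) : F) * x) ≤ r := by
    intro x
    obtain ⟨j, hj⟩ := exists_pow_lt_of_lt_one (x := r / (vabs F x + 1))
      (div_pos hr0 (by linarith [vabs_nonneg x])) ha
    refine ⟨j, ?_⟩
    rw [map_mul, Units.val_pow_eq_pow_val, map_pow]
    rw [lt_div_iff₀ (by linarith [vabs_nonneg x])] at hj
    nlinarith [pow_nonneg (vabs_nonneg (a : F)) j]
  have hinj : ∀ (g : GL2 F) (v v' : V), σ g v = σ g v' → v = v' := by
    intro g v v' h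
    have := congrArg (σ g⁻¹) h
    simpa [← Module.End.mul_apply, ← map_mul] using this
  -- Mautner's argument: conjugation by a high power of `diagOne a` moves any unipotent into the
  -- congruence subgroup, while that power only rescales `w`.
  have hup : ∀ x, σ (upperUnip x) w = w := by
    intro x
    obtain ⟨j, hj⟩ := hsmall x
    apply hinj (diagOne a ^ j)
    rw [← Module.End.mul_apply, ← map_mul, diagOne_pow, diagOne_mul_upperUnip, map_mul,
      Module.End.mul_apply, ← diagOne_pow, hpow, map_smul, hw _ (upperUnip_mem_congruence hj)]
  have hlow : ∀ x, σ (lowerUnip x) w = w := by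
    intro x
    obtain ⟨j, hj⟩ := hsmall x
    have h : σ (lowerUnip x) (σ (diagOne a ^ j) w) = σ (diagOne a ^ j) w := by
      rw [← Module.End.mul_apply, ← map_mul, diagOne_pow, lowerUnip_mul_diagOne, map_mul,
        Module.End.mul_apply, hw _ (lowerUnip_mem_congruence hj)]
    rw [hpow, map_smul] at h
    exact smul_right_injective V (pow_ne_zero j hc) h
  -- Such a `g` is `diag(det g, 1)`, which lies in the congruence subgroup, times an element of
  -- `SL₂(F)`, which is generated by unipotents.
  have hfix : ∀ g : GL2 F, vabs F ((g : Matrix (Fin 2) (Fin 2) F).det - 1) ≤ r → σ g w = w := by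
    intro g hg
    set d : Fˣ := Matrix.GeneralLinearGroup.det g with hd
    have hd' : (d : F) = (g : Matrix (Fin 2) (Fin 2) F).det := rfl
    have hd1 : vabs F (d : F) = 1 := by
      have e : (d : F) = 1 + ((g : Matrix (Fin 2) (Fin 2) F).det - 1) := by rw [hd']; ring
      rw [e, vabs_add_eq_left, map_one]
      rw [map_one]
      exact hg.trans_lt hr1
    let S : Subgroup (GL2 F) :=
      { carrier := {g | σ g w = w}
        one_mem' := by simp
        mul_mem' := by
          intro g h hg hh
          change σ (g * h) w = w
          rw [map_mul, Module.End.mul_apply, hh, hg]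
        inv_mem' := by
          intro g hg
          apply hinj g
          rw [← Module.End.mul_apply, ← map_mul, mul_inv_cancel, map_one, hg]
          rfl }
    have hS : (diagOne d)⁻¹ * g ∈ S := by
      refine mem_of_det_eq_one hup hlow ?_
      have h1 : Matrix.GeneralLinearGroup.det (diagOne d) = d :=
        Units.ext (by simp [diagOne, Matrix.det_fin_two_of])
      have h2 : Matrix.GeneralLinearGroup.det ((diagOne d)⁻¹ * g) = 1 := by
        rw [map_mul, map_inv, h1, ← hd, inv_mul_cancel]
      exact congrArg Units.val h2
    have hd2 : diagOne d ∈ S := hw _ (diagOne_mem_congruence hd1 hg)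
    have := mul_mem hd2 hS
    rwa [mul_inv_cancel_left] at this
  -- The condition on `g` depends only on its determinant, so it is stable under conjugation and `U`
  -- is a subrepresentation. If `U` is everything, the congruence subgroup acts trivially and `V` is
  -- its finite-dimensional space of fixed vectors.
  let U : Submodule ℂ V :=
    { carrier := {v | ∀ g : GL2 F, vabs F ((g : Matrix (Fin 2) (Fin 2) F).det - 1) ≤ r → σ g v = v}
      zero_mem' := fun _ _ => map_zero _
      add_mem' := fun hv hw g hg => by rw [map_add, hv g hg, hw g hg]
      smul_mem' := fun c v hv g hg => by rw [map_smul, hv g hg] }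
  have hwU : w ∈ U := hfix
  rcases hirr U (fun h v hv g hg => by
    have e : g * h = h * (h⁻¹ * g * h) := by group
    rw [← Module.End.mul_apply, ← map_mul, e, map_mul, Module.End.mul_apply, hv]
    rwa [det_conj]) with hU | hU
  · rw [hU] at hwU
    exact (Submodule.mem_bot ℂ).1 hwU
  · refine absurd ?_ hinf
    have htop : fixedVectors σ (congruence r hr0 hr1.le) = ⊤ := by
      rw [eq_top_iff]
      intro v _ k hk
      have hv : v ∈ U := by rw [hU]; trivial
      refine hv k ?_
      have h00 := hk.1 0 0
      have h01 := hk.1 0 1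
      have h10 := hk.1 1 0
      have h11 := hk.1 1 1
      have hle := vabs_apply_le_one hr1.le hk.1 1 1
      simp only [Matrix.sub_apply, Matrix.one_apply_eq, Matrix.one_apply_ne (one_ne_zero),
        Matrix.one_apply_ne (zero_ne_one), sub_zero] at h00 h01 h10 h11
      have e : (k : Matrix (Fin 2) (Fin 2) F).det - 1 =
          ((k 0 0 - 1) * k 1 1 + (k 1 1 - 1)) - k 0 1 * k 1 0 := by
        rw [Matrix.det_fin_two]; ring
      rw [e]
      refine vabs_sub_le (vabs_add_le ?_ h11) ?_
      · rw [map_mul]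
        nlinarith [vabs_nonneg (k 1 1), vabs_nonneg (k 0 0 - 1)]
      · rw [map_mul]
        nlinarith [vabs_nonneg (k 0 1), vabs_nonneg (k 1 0)]
    rw [htop] at hfin
    exact Module.Finite.equiv (Submodule.topEquiv (R := ℂ) (M := V))

/-- Matrix coefficients of an infinite-dimensional irreducible admissible unitary representation
decay exponentially along the powers of `diag(a, 1)`, where `|a| < 1`. -/
theorem exists_inner_diagOne_pow_le (hu : IsUnitaryRep σ)
    (hirr : ∀ W : Submodule ℂ V, (∀ g, ∀ w ∈ W, σ g w ∈ W) → W = ⊥ ∨ W = ⊤)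
    (hinf : ¬ FiniteDimensional ℂ V)
    (hfin : ∀ (r : ℝ) (hr0 : 0 < r) (hr1 : r ≤ 1),
      FiniteDimensional ℂ (fixedVectors σ (congruence r hr0 hr1)))
    {r : ℝ} {hr0 : 0 < r} (hr1 : r < 1) {a : Fˣ} (ha : vabs F a < 1) :
    ∃ C ρ : ℝ, 0 ≤ C ∧ 0 < ρ ∧ ρ < 1 ∧
      ∀ v ∈ fixedVectors σ (congruence r hr0 hr1.le),
      ∀ w ∈ fixedVectors σ (congruence r hr0 hr1.le),
      ∀ m : ℕ, ‖(inner ℂ v (σ (diagOne a ^ m) w) : ℂ)‖ ≤ C * ρ ^ m * (‖v‖ * ‖w‖) := by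
  set K : Subgroup (GL2 F) := congruence r hr0 hr1.le with hK
  set W := fixedVectors σ K with hW
  have : FiniteDimensional ℂ W := hfin r hr0 hr1.le
  let T : W →L[ℂ] W := LinearMap.toContinuousLinearMap
    (W.orthogonalProjectionOnto.toLinearMap ∘ₗ σ (diagOne a) ∘ₗ W.subtype)
  have hT : ∀ w : W, T w = W.orthogonalProjectionOnto (σ (diagOne a) w) := fun _ => rfl
  have hinner : ∀ v w : W, inner ℂ v (T w) = inner ℂ (v : V) (σ (diagOne a) w) := by
    intro v w
    rw [hT, Submodule.inner_orthogonalProjectionOnto_eq_of_mem_left]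
  -- The crucial point: the projection in `T` is invisible to the coefficient at `diagOne a ^ m`, so
  -- these coefficients are given by powers of `T`.
  have hstep : ∀ (m : ℕ) (v w : W), inner ℂ (v : V) (σ (diagOne a ^ m) (T w)) =
      inner ℂ (v : V) (σ (diagOne a ^ (m + 1)) w) := by
    intro m v w
    have ha0 : 0 < vabs F (a : F) := vabs_pos a.ne_zero
    have hra : r * vabs F a ≤ r := by nlinarith
    -- Conjugation by `diagOne a` divides the upper-right entry by `a`, so `σ (diagOne a) w` is
    -- fixed at the smaller radius `r |a|`. Since `K` normalizes `K'`, the `K`-translates of this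
    -- vector span a finite-dimensional space.
    set K' : Subgroup (GL2 F) := congruence (r * vabs F a) (mul_pos hr0 ha0) (hra.trans hr1.le)
    have : FiniteDimensional ℂ (fixedVectors σ K') := hfin _ _ _
    have hx : σ (diagOne a) (w : V) ∈ fixedVectors σ K' := by
      refine apply_mem_fixedVectors w.2 fun k hk => ⟨fun i j => ?_, ?_⟩
      · have h := hk.1 i j
        rw [Matrix.sub_apply] at h
        rw [Matrix.sub_apply, coe_conj_diagOne]
        fin_cases i <;> fin_cases j
        · exact h.trans hra
        · simp at h ⊢
          rwa [inv_mul_le_iff₀ ha0, mul_comm]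
        · simp at h ⊢
          nlinarith [vabs_nonneg (k 1 0)]
        · exact h.trans hra
      · rw [det_conj]
        exact hk.2
    obtain ⟨p, hp, hxp⟩ := hu.exists_fixed_sub_mem_span K (σ (diagOne a) w) (fixedVectors σ K')
      fun k hk => apply_mem_fixedVectors hx fun l hl =>
        conj_mem_congruence (congruence_mono hr1.le hk) hl
    -- On a generator `σ k x - x`, with `x = σ (diagOne a) w`, the factorization `a^m k a = k'
    -- a^(m+1) k''` makes the two coefficients equal.
    have hzero : ∀ (m : ℕ) (v : W),
        inner ℂ (v : V) (σ (diagOne a ^ m) (σ (diagOne a) w - p)) = 0 := by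
      intro m v
      generalize σ (diagOne a) (w : V) - p = y at hxp
      induction hxp using Submodule.span_induction with
      | mem y hy =>
        obtain ⟨k, hk, rfl⟩ := hy
        obtain ⟨k', hk', k'', hk'', e⟩ := diagOne_pow_mul_mul_diagOne hr1 ha.le hk m
        dsimp only
        rw [map_sub, ← Module.End.mul_apply, ← Module.End.mul_apply, ← Module.End.mul_apply,
          ← map_mul, ← map_mul, ← map_mul, e, inner_sub_right,
          hu.inner_mul_apply v.2 w.2 hk' hk'', pow_succ, sub_self]
      | zero => simp
      | add y z _ _ hy hz => rw [map_add, inner_add_right, hy, hz, add_zero]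
      | smul c y _ hy => rw [map_smul, inner_smul_right, hy, mul_zero]
    -- The case `m = 0` of `hzero` says that `σ (diagOne a) w - p` is orthogonal to `W`, so the
    -- average `p` is the orthogonal projection.
    have hTp : (T w : V) = p := by
      rw [hT, Submodule.coe_orthogonalProjectionOnto_apply]
      refine Submodule.eq_starProjection_of_mem_orthogonal hp ?_
      rw [Submodule.mem_orthogonal]
      intro v hv
      have := hzero 0 ⟨v, hv⟩
      rwa [pow_zero, map_one] at this
    have h := hzero m v
    rw [map_sub, inner_sub_right, sub_eq_zero, ← Module.End.mul_apply, ← map_mul, ← pow_succ] at h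
    rw [hTp, h]
  have hpow : ∀ (m : ℕ) (v w : W), inner ℂ v ((T ^ m) w) =
      inner ℂ (v : V) (σ (diagOne a ^ m) w) := by
    intro m
    induction m with
    | zero => intro v w; simp
    | succ m ih =>
      intro v w
      rw [pow_succ, mul_apply_eq_comp, ih, hstep]
  -- Cauchy–Schwarz gives `‖μ‖ ≤ 1`. In the case of equality, expanding `‖σ (diagOne a) w - μ w‖²`
  -- gives `0`, so `w` is an eigenvector before projection and must vanish.
  obtain ⟨C, ρ, hC, hρ0, hρ1, h⟩ := exists_norm_pow_le_of_eigenvalues T (by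
    intro μ w hw0 hTw
    have hw0' : 0 < ‖(w : V)‖ := norm_pos_iff.2 fun h => hw0 (Subtype.ext h)
    have h1 : inner ℂ (w : V) (σ (diagOne a) w) = μ * (‖(w : V)‖ : ℂ) ^ 2 := by
      rw [← hinner, hTw, inner_smul_right, inner_self_eq_norm_sq_to_K]
      rfl
    have h2 : ‖μ‖ ≤ 1 := by
      have := norm_inner_le_norm (𝕜 := ℂ) (w : V) (σ (diagOne a) w)
      rw [h1, hu.norm_apply, norm_mul, norm_pow, Complex.norm_real, norm_norm] at this
      nlinarith [mul_pos hw0' hw0']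
    refine lt_of_le_of_ne h2 fun hμ => hw0 (Subtype.ext ?_)
    have h3 : σ (diagOne a) (w : V) = μ • (w : V) := by
      rw [← sub_eq_zero, ← norm_eq_zero, ← sq_eq_zero_iff, @norm_sub_sq ℂ, hu.norm_apply,
        norm_smul, hμ, one_mul, ← inner_conj_symm, inner_smul_left, h1]
      have : (starRingEnd ℂ) μ * (μ * (‖(w : V)‖ : ℂ) ^ 2) = ((‖(w : V)‖ ^ 2 : ℝ) : ℂ) := by
        rw [← mul_assoc, ← Complex.normSq_eq_conj_mul_self, Complex.normSq_eq_norm_sq, hμ]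
        simp
      rw [this, Complex.conj_ofReal]
      simp only [RCLike.re_to_complex, Complex.ofReal_re]
      ring
    exact eq_zero_of_diagOne_eigenvector hirr hinf hr1 (hfin r hr0 hr1.le) ha w.2
      (fun h => by simp [h] at hμ) h3)
  refine ⟨C, ρ, hC, hρ0, hρ1, fun v hv w hw m => ?_⟩
  have e := hpow m ⟨v, hv⟩ ⟨w, hw⟩
  rw [← show _ = inner ℂ v (σ (diagOne a ^ m) w) from e]
  calc _ ≤ ‖(⟨v, hv⟩ : W)‖ * ‖(T ^ m) ⟨w, hw⟩‖ := norm_inner_le_norm _ _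
    _ ≤ ‖v‖ * (C * ρ ^ m * ‖w‖) := by
      refine mul_le_mul_of_nonneg_left ?_ (norm_nonneg _)
      exact ((T ^ m).le_opNorm _).trans (mul_le_mul_of_nonneg_right (h m) (norm_nonneg _))
    _ = _ := by ring

end Decay

/-! ### Cartan decomposition and the bound in terms of entries -/

section Cartan

variable {F : Type*} [Field F] [ValuativeRel F] [TopologicalSpace F] [IsNonarchimedeanLocalField F]

/-- The Cartan decomposition of `GL₂(F)`, with the control of the exponent by the entries. -/
theorem exists_cartan (ϖ : Fˣ) (hϖ : ∃ x : 𝒪[F], Irreducible x ∧ (x : F) = ϖ) (g : GL2 F) :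
    ∃ k ∈ congruence (F := F) 1 one_pos le_rfl, ∃ k' ∈ congruence (F := F) 1 one_pos le_rfl,
    ∃ (m : ℕ) (z : GL2 F), (∀ h, z * h = h * z) ∧ g = k * diagOne ϖ ^ m * z * k' ∧
      ∀ i j, vabs F ϖ ^ m * vabs F (g i j) ^ 2 ≤ vabs F (g : Matrix (Fin 2) (Fin 2) F).det := by
  obtain ⟨x, hx, hxϖ⟩ := hϖ
  have hϖ01 := vabs_irreducible hx
  rw [hxϖ] at hϖ01
  -- When the lower-right entry is the largest, integral unipotents clear its row and column. What
  -- is left is `g 1 1 · diag(det g / (g 1 1)², 1)`, so `m` is the valuation of `det g / (g 1 1)²`,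
  -- nonnegative by maximality.
  have key : ∀ g : GL2 F, (∀ i j, vabs F (g i j) ≤ vabs F (g 1 1)) →
      ∃ k ∈ congruence (F := F) 1 one_pos le_rfl, ∃ k' ∈ congruence (F := F) 1 one_pos le_rfl,
      ∃ (m : ℕ) (z : GL2 F), (∀ h, z * h = h * z) ∧ g = k * diagOne ϖ ^ m * z * k' ∧
      ∀ i j, vabs F ϖ ^ m * vabs F (g i j) ^ 2 ≤ vabs F (g : Matrix (Fin 2) (Fin 2) F).det := by
    intro g hg
    have hd0 : (g : Matrix (Fin 2) (Fin 2) F).det ≠ 0 :=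
      (Matrix.GeneralLinearGroup.det g).ne_zero
    set d := (g : Matrix (Fin 2) (Fin 2) F).det with hd
    have hs0 : g 1 1 ≠ 0 := by
      intro h
      have h0 : ∀ i j, g i j = 0 := by
        intro i j
        have := hg i j
        rw [h, map_zero] at this
        exact (map_eq_zero (vabs F)).1 (le_antisymm this (vabs_nonneg _))
      apply hd0
      rw [hd, Matrix.det_fin_two, h0, h0 0 1]
      simp
    have hs := vabs_pos hs0
    have hdle : vabs F d ≤ vabs F (g 1 1) ^ 2 := by
      rw [hd, Matrix.det_fin_two, sq]
      refine vabs_sub_le ?_ ?_ <;> rw [map_mul]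
      · exact mul_le_mul (hg _ _) le_rfl (vabs_nonneg _) hs.le
      · exact mul_le_mul (hg _ _) (hg _ _) (vabs_nonneg _) hs.le
    obtain ⟨k, u, hu1, huk⟩ := exists_zpow_mul_of_irreducible hx
      (div_ne_zero hd0 (pow_ne_zero 2 hs0))
    rw [hxϖ] at huk
    have hval := congrArg (vabs F) huk
    rw [map_div₀, map_mul, hu1, one_mul, map_pow, map_zpow₀] at hval
    obtain ⟨m, rfl⟩ : ∃ m : ℕ, k = m := by
      refine Int.eq_ofNat_of_zero_le ?_
      by_contra! hk
      have h1 : 1 < vabs F ϖ ^ k := one_lt_zpow_of_neg₀ hϖ01.1 hϖ01.2 hk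
      rw [← hval, one_lt_div (by positivity)] at h1
      exact absurd hdle (not_le.2 h1)
    rw [zpow_natCast] at huk hval
    have hu0 : u ≠ 0 := by
      intro h
      rw [h, map_zero] at hu1
      exact zero_ne_one hu1
    let z : GL2 F :=
      { val := !![g 1 1, 0; 0, g 1 1]
        inv := !![(g 1 1)⁻¹, 0; 0, (g 1 1)⁻¹]
        val_inv := by ext i j; fin_cases i <;> fin_cases j <;> simp [hs0]
        inv_val := by ext i j; fin_cases i <;> fin_cases j <;> simp [hs0] }
    refine ⟨upperUnip (g 0 1 / g 1 1), upperUnip_mem_congruence ?_,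
      diagOne (Units.mk0 u hu0) * lowerUnip (g 1 0 / g 1 1), mul_mem
        (diagOne_mem_congruence hu1 ?_) (lowerUnip_mem_congruence ?_), m, z, ?_, ?_, ?_⟩
    · rw [map_div₀]; exact div_le_one_of_le₀ (hg _ _) hs.le
    · exact vabs_sub_le hu1.le (map_one (vabs F)).le
    · rw [map_div₀]; exact div_le_one_of_le₀ (hg _ _) hs.le
    · intro h
      ext i j; fin_cases i <;> fin_cases j <;> simp [z, Matrix.mul_apply, mul_comm]
    · have hk : g 0 0 * g 1 1 - g 0 1 * g 1 0 = u * (ϖ : F) ^ m * g 1 1 ^ 2 := by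
        rw [← huk, hd, Matrix.det_fin_two]
        field_simp
      rw [diagOne_pow]
      ext i j; fin_cases i <;> fin_cases j <;>
        simp [z, upperUnip, lowerUnip, diagOne, Matrix.mul_apply, hs0]
      · apply mul_right_cancel₀ hs0
        field_simp
        linear_combination hk
      · field_simp
    · intro i j
      rw [← hval, div_mul_eq_mul_div, div_le_iff₀ (by positivity)]
      have := pow_le_pow_left₀ (vabs_nonneg _) (hg i j) 2
      exact mul_le_mul_of_nonneg_left this (vabs_nonneg _)
  -- The Weyl element on either side moves a largest entry to the lower-right corner without
  -- changing `|det g|`.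
  let s : GL2 F :=
    { val := !![0, 1; 1, 0]
      inv := !![0, 1; 1, 0]
      val_inv := by ext i j; fin_cases i <;> fin_cases j <;> simp
      inv_val := by ext i j; fin_cases i <;> fin_cases j <;> simp }
  have hss : s * s = 1 := by ext i j; fin_cases i <;> fin_cases j <;> simp [s]
  have hsK : s ∈ congruence (F := F) 1 one_pos le_rfl := by
    refine mem_congruence_one.2 ⟨fun i j => ?_, by simp [s, Matrix.det_fin_two_of]⟩
    fin_cases i <;> fin_cases j <;> simp [s]
  have hsdet : ∀ g : GL2 F, vabs F ((s * g : GL2 F) : Matrix (Fin 2) (Fin 2) F).det =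
      vabs F (g : Matrix (Fin 2) (Fin 2) F).det := by
    intro g
    rw [Units.val_mul, Matrix.det_mul, map_mul, (mem_congruence_one.1 hsK).2, one_mul]
  have hsdet' : ∀ g : GL2 F, vabs F ((g * s : GL2 F) : Matrix (Fin 2) (Fin 2) F).det =
      vabs F (g : Matrix (Fin 2) (Fin 2) F).det := by
    intro g
    rw [Units.val_mul, Matrix.det_mul, map_mul, (mem_congruence_one.1 hsK).2, mul_one]
  have hsl : ∀ (g : GL2 F) (i j : Fin 2), (s * g : GL2 F) i j = g (1 - i) j := by
    intro g i j
    fin_cases i <;> simp [s, Matrix.mul_apply, Fin.sum_univ_two]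
  have hsr : ∀ (g : GL2 F) (i j : Fin 2), (g * s : GL2 F) i j = g i (1 - j) := by
    intro g i j
    fin_cases j <;> simp [s, Matrix.mul_apply, Fin.sum_univ_two]
  have key2 : ∀ g : GL2 F, (∃ j, ∀ i j', vabs F (g i j') ≤ vabs F (g 1 j)) →
      ∃ k ∈ congruence (F := F) 1 one_pos le_rfl, ∃ k' ∈ congruence (F := F) 1 one_pos le_rfl,
      ∃ (m : ℕ) (z : GL2 F), (∀ h, z * h = h * z) ∧ g = k * diagOne ϖ ^ m * z * k' ∧
      ∀ i j, vabs F ϖ ^ m * vabs F (g i j) ^ 2 ≤ vabs F (g : Matrix (Fin 2) (Fin 2) F).det := by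
    rintro g ⟨j, hj⟩
    by_cases hj1 : j = 1
    · exact key g (by rwa [hj1] at hj)
    · have hj0 : j = 0 := by omega
      obtain ⟨k, hk, k', hk', m, z, hz, e, h⟩ := key (g * s) (fun i j => by
        rw [hsr, hsr]; rw [hj0] at hj; exact hj _ _)
      refine ⟨k, hk, k' * s, mul_mem hk' hsK, m, z, hz, ?_, fun i j => ?_⟩
      · rw [← mul_assoc, ← e, mul_assoc, hss, mul_one]
      · have := h i (1 - j)
        rwa [hsr, sub_sub_cancel, hsdet'] at this
  obtain ⟨⟨i, j⟩, hij⟩ := Finite.exists_max fun p : Fin 2 × Fin 2 => vabs F (g p.1 p.2)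
  by_cases hi1 : i = 1
  · exact key2 g ⟨j, fun i' j' => by simpa [hi1] using hij (i', j')⟩
  · have hi0 : i = 0 := by omega
    obtain ⟨k, hk, k', hk', m, z, hz, e, h⟩ := key2 (s * g) ⟨j, fun i' j' => by
      rw [hsl, hsl]; simpa [hi0] using hij (1 - i', j')⟩
    refine ⟨s * k, mul_mem hsK hk, k', hk', m, z, hz, ?_, fun i j => ?_⟩
    · rw [mul_assoc s, mul_assoc s, mul_assoc s, ← e, ← mul_assoc, hss, one_mul]
    · have := h (1 - i) j
      rwa [hsl, sub_sub_cancel, hsdet] at this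

end Cartan

section MatrixCoefficientBound

variable {F : Type*} [Field F] [ValuativeRel F] [TopologicalSpace F] [IsNonarchimedeanLocalField F]
  {V : Type*} [NormedAddCommGroup V] [InnerProductSpace ℂ V] {σ : Representation ℂ (GL2 F) V}

/-- The decay of the matrix coefficients of an infinite-dimensional irreducible admissible unitary
representation of `GL₂(F)`, in terms of the entries of the matrix. -/
theorem exists_norm_inner_le_rpow (hu : IsUnitaryRep σ)
    (hirr : ∀ W : Submodule ℂ V, (∀ g, ∀ w ∈ W, σ g w ∈ W) → W = ⊥ ∨ W = ⊤)
    (hinf : ¬ FiniteDimensional ℂ V)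
    (hfin : ∀ (r : ℝ) (hr0 : 0 < r) (hr1 : r ≤ 1),
      FiniteDimensional ℂ (fixedVectors σ (congruence r hr0 hr1)))
    {r : ℝ} {hr0 : 0 < r} (hr1 : r < 1) {φ : V}
    (hφ : φ ∈ fixedVectors σ (congruence r hr0 hr1.le)) :
    ∃ C s₀ : ℝ, 0 ≤ C ∧ 0 < s₀ ∧ ∀ s, 0 < s → s ≤ s₀ → ∀ (g : GL2 F) (i j : Fin 2), g i j ≠ 0 →
      ‖(inner ℂ φ (σ g φ) : ℂ)‖ ≤
        C * (vabs F (g : Matrix (Fin 2) (Fin 2) F).det / vabs F (g i j) ^ 2) ^ s := by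
  obtain ⟨x, hx⟩ := IsDiscreteValuationRing.exists_irreducible 𝒪[F]
  obtain ⟨hω0, hω1⟩ := vabs_irreducible hx
  have hx0 : (x : F) ≠ 0 := fun h => hx.ne_zero (Subtype.ext h)
  set ϖ : Fˣ := Units.mk0 (x : F) hx0 with hϖ
  have hω : vabs F (ϖ : F) = vabs F (x : F) := rfl
  obtain ⟨C, ρ, hC, hρ0, hρ1, h⟩ := exists_inner_diagOne_pow_le (r := r) (hr0 := hr0) hu hirr hinf
    hfin hr1 (a := ϖ) hω1
  have hlogω : Real.log (vabs F (x : F)) < 0 := Real.log_neg hω0 hω1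
  have hlogρ : Real.log ρ < 0 := Real.log_neg hρ0 hρ1
  -- The threshold `s₀` is defined by `|ϖ| ^ s₀ = ρ`, so that `ρ ^ m ≤ (|ϖ| ^ m) ^ s` for `s ≤ s₀`.
  refine ⟨C * (‖φ‖ * ‖φ‖), Real.log ρ / Real.log (vabs F (x : F)), by positivity,
    div_pos_of_neg_of_neg hlogρ hlogω, fun s hs hs0 g i j hgij => ?_⟩
  obtain ⟨k, hk, k', hk', m, z, hz, e, hm⟩ := exists_cartan ϖ ⟨x, hx, rfl⟩ g
  -- The maximal compact subgroup normalizes the congruence subgroup and `z` is central, so both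
  -- vectors stay in one fixed space; the constants are uniform in `k`, `k'` and `z`.
  have h1 : σ k⁻¹ φ ∈ fixedVectors σ (congruence r hr0 hr1.le) :=
    apply_mem_fixedVectors hφ fun l hl => conj_mem_congruence (inv_mem hk) hl
  have h2 : σ (z * k') φ ∈ fixedVectors σ (congruence r hr0 hr1.le) := by
    refine apply_mem_fixedVectors hφ fun l hl => ?_
    have e : (z * k')⁻¹ * l * (z * k') = k'⁻¹ * l * k' := by
      rw [mul_inv_rev, mul_assoc k'⁻¹, mul_assoc k'⁻¹, mul_assoc k'⁻¹]
      congr 1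
      rw [mul_assoc, ← mul_assoc l, ← hz l]
      group
    rw [e]
    exact conj_mem_congruence hk' hl
  have h3 : inner ℂ φ (σ g φ) = inner ℂ (σ k⁻¹ φ) (σ (diagOne ϖ ^ m) (σ (z * k') φ)) := by
    rw [← hu.inner_apply_right, ← Module.End.mul_apply, ← Module.End.mul_apply, ← map_mul,
      ← map_mul, e]
    simp only [mul_assoc]
  rw [h3]
  refine (h _ h1 _ h2 m).trans ?_
  rw [hu.norm_apply, hu.norm_apply]
  have hg := vabs_pos hgij
  have h4 : ρ ^ m ≤ (vabs F (x : F) ^ m) ^ s := by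
    rw [← Real.rpow_natCast, ← Real.rpow_natCast, ← Real.rpow_mul hω0.le,
      Real.rpow_def_of_pos hρ0, Real.rpow_def_of_pos hω0, Real.exp_le_exp]
    have : Real.log ρ ≤ Real.log (vabs F (x : F)) * s := by
      rw [le_div_iff_of_neg hlogω] at hs0
      linarith
    nlinarith [(Nat.cast_nonneg m : (0 : ℝ) ≤ m)]
  have h5 : (vabs F (x : F) ^ m) ^ s ≤
      (vabs F (g : Matrix (Fin 2) (Fin 2) F).det / vabs F (g i j) ^ 2) ^ s := by
    refine Real.rpow_le_rpow (by positivity) ?_ hs.le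
    rw [le_div_iff₀ (by positivity)]
    exact hm i j
  have h6 : C * ρ ^ m * (‖φ‖ * ‖φ‖) = C * (‖φ‖ * ‖φ‖) * ρ ^ m := by ring
  rw [h6]
  exact mul_le_mul_of_nonneg_left (h4.trans h5) (by positivity)

end MatrixCoefficientBound

/-! ### Integrability of small negative powers on a group -/

section Integral

variable {G : Type*} [Group G] [TopologicalSpace G] [IsTopologicalGroup G] [MeasurableSpace G]
  [BorelSpace G] (μ : Measure G) [μ.IsHaarMeasure]

/-- The measures of the sublevel sets of `Q` decay exponentially if these are subgroups, strictly
decreasing along a geometric progression. -/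
theorem measure_sublevel_le {Q : G → ℝ} (hQc : Continuous Q) {ε l : ℝ} (hε : 0 < ε) (hl : 1 < l)
    (hsub : ∀ d ≤ ε, ∀ x y, Q x ≤ d → Q y ≤ d → Q (x⁻¹ * y) ≤ d)
    (hstrict : ∀ j : ℕ, ∃ x, Q x ≤ ε / l ^ j ∧ ε / l ^ (j + 1) < Q x) (j : ℕ) :
    μ {x | Q x ≤ ε / l ^ j} ≤ μ {x | Q x ≤ ε} * (1 / 2) ^ j := by
  have hle : ∀ j : ℕ, ε / l ^ j ≤ ε := fun j =>
    div_le_self hε.le (one_le_pow₀ hl.le)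
  have hanti : ∀ j : ℕ, ε / l ^ (j + 1) ≤ ε / l ^ j := fun j =>
    div_le_div_of_nonneg_left hε.le (by positivity) (pow_le_pow_right₀ hl.le j.le_succ)
  have hmeas : ∀ d, MeasurableSet {x | Q x ≤ d} := fun d =>
    (isClosed_le hQc continuous_const).measurableSet
  have hhalf : ∀ j : ℕ, μ {x | Q x ≤ ε / l ^ (j + 1)} ≤ μ {x | Q x ≤ ε / l ^ j} * (1 / 2) := by
    intro j
    obtain ⟨x, hx1, hx2⟩ := hstrict j
    obtain ⟨y, hy, -⟩ := hstrict (j + 1)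
    set d := ε / l ^ (j + 1) with hd
    have h1 : Q 1 ≤ d := by simpa using hsub d (hle _) y y hy hy
    have hinv : ∀ z, Q z ≤ d → Q z⁻¹ ≤ d := fun z hz => by simpa using hsub d (hle _) z 1 hz h1
    -- The subgroup `H = {Q ≤ d}` and its coset `x H` are disjoint because `x ∉ H`, and both lie in
    -- the next larger sublevel set, whose measure is therefore at least twice that of `H`.
    have hdisj : Disjoint {z | Q z ≤ d} ((fun z => x⁻¹ * z) ⁻¹' {z | Q z ≤ d}) := by
      rw [Set.disjoint_left]
      intro z hz hz'
      have h := hsub d (hle _) _ _ (hinv _ hz) (hinv _ hz')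
      rw [inv_inv, mul_inv_rev, inv_inv, mul_inv_cancel_left] at h
      exact absurd h (not_le.2 hx2)
    have hsubset : {z | Q z ≤ d} ∪ ((fun z => x⁻¹ * z) ⁻¹' {z | Q z ≤ d}) ⊆
        {z | Q z ≤ ε / l ^ j} := by
      have h1' : Q 1 ≤ ε / l ^ j := h1.trans (hanti j)
      rintro z (hz | hz)
      · exact hz.trans (hanti j)
      · have hxi : Q x⁻¹ ≤ ε / l ^ j := by simpa using hsub _ (hle _) x 1 hx1 h1'
        have h := hsub _ (hle _) _ _ hxi (le_trans hz (hanti j))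
        simpa using h
    have h2 := measure_mono (μ := μ) hsubset
    rw [measure_union hdisj (by simpa using (measurable_const_mul x⁻¹) (hmeas d)),
      measure_preimage_mul, ← mul_two] at h2
    rw [one_div, ← div_eq_mul_inv, ENNReal.le_div_iff_mul_le (by simp) (by simp)]
    exact h2
  induction j with
  | zero => simp
  | succ j ih =>
    calc _ ≤ μ {x | Q x ≤ ε / l ^ j} * (1 / 2) := hhalf j
      _ ≤ μ {x | Q x ≤ ε} * (1 / 2) ^ j * (1 / 2) := by gcongr
      _ = _ := by rw [pow_succ, mul_assoc]

/-- The annuli of `Q` have bounded measure if, far out, each of them is covered by two translates of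
a fixed sublevel set. -/
theorem exists_measure_annulus_le {Q : G → ℝ} (hcomp : ∀ R, IsCompact {x | Q x ≤ R})
    {l R R₀ : ℝ} (hl : 0 < l)
    (hinf : ∀ t x y, R₀ ≤ t → t ≤ Q x → Q x ≤ l * t → t ≤ Q y → Q y ≤ l * t →
      Q (x⁻¹ * y) ≤ R ∨ Q (x * y) ≤ R) :
    ∃ M : ENNReal, M ≠ ⊤ ∧ ∀ t, μ {x | t ≤ Q x ∧ Q x ≤ l * t} ≤ M := by
  have hfin : ∀ R, μ {x | Q x ≤ R} ≠ ⊤ := fun R => (hcomp R).measure_lt_top.ne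
  refine ⟨μ {x | Q x ≤ l * R₀} + (μ {x | Q x ≤ R} + μ {x | Q x ≤ R}),
    ENNReal.add_ne_top.2 ⟨hfin _, ENNReal.add_ne_top.2 ⟨hfin _, hfin _⟩⟩, fun t => ?_⟩
  rcases lt_or_ge t R₀ with ht | ht
  · refine (measure_mono fun x hx => ?_).trans le_self_add
    exact hx.2.trans (mul_le_mul_of_nonneg_left ht.le hl.le)
  · refine le_trans ?_ le_add_self
    rcases Set.eq_empty_or_nonempty {x | t ≤ Q x ∧ Q x ≤ l * t} with he | ⟨y, hy1, hy2⟩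
    · rw [he]; simp
    · calc μ {x | t ≤ Q x ∧ Q x ≤ l * t}
          ≤ μ (((fun z => y⁻¹ * z) ⁻¹' {x | Q x ≤ R}) ∪ ((fun z => y * z) ⁻¹' {x | Q x ≤ R})) :=
            measure_mono fun x hx => hinf t y x ht hy1 hy2 hx.1 hx.2
        _ ≤ _ := measure_union_le _ _
        _ = _ := by rw [measure_preimage_mul, measure_preimage_mul]

/-- Integrability of small negative powers of a proper function `Q` whose sublevel sets decrease
exponentially near `Q = 0` and whose annuli have bounded measure near infinity. -/
theorem exists_lintegral_rpow_neg_lt_top {Q : G → ℝ} (hQc : Continuous Q)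
    (hcomp : ∀ R, IsCompact {x | Q x ≤ R}) {ε l R R₀ : ℝ} (hε : 0 < ε) (hl : 1 < l)
    (hsub : ∀ d ≤ ε, ∀ x y, Q x ≤ d → Q y ≤ d → Q (x⁻¹ * y) ≤ d)
    (hstrict : ∀ j : ℕ, ∃ x, Q x ≤ ε / l ^ j ∧ ε / l ^ (j + 1) < Q x)
    (hinf : ∀ t x y, R₀ ≤ t → t ≤ Q x → Q x ≤ l * t → t ≤ Q y → Q y ≤ l * t →
      Q (x⁻¹ * y) ≤ R ∨ Q (x * y) ≤ R) :
    ∃ s₀ : ℝ, 0 < s₀ ∧ ∀ s, 0 < s → s ≤ s₀ →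
      ∫⁻ x, ENNReal.ofReal (Q x) ^ (-s) ∂μ < ⊤ := by
  have hl0 : 0 < l := one_pos.trans hl
  have hlog : 0 < Real.log l := Real.log_pos hl
  -- This choice gives `l ^ s ≤ √2`, so growth by `l ^ s` per annulus near `Q = 0` loses against the
  -- halving of the measure.
  refine ⟨Real.log 2 / (2 * Real.log l), by positivity, fun s hs hs0 => ?_⟩
  have hls : l ^ s < 2 := by
    rw [Real.rpow_def_of_pos hl0, ← Real.lt_log_iff_exp_lt two_pos]
    rw [le_div_iff₀ (by positivity)] at hs0
    nlinarith [Real.log_pos one_lt_two]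
  have hls' : l ^ (-s) < 1 := Real.rpow_lt_one_of_one_lt_of_neg hl (by linarith)
  set f : G → ENNReal := fun x => ENNReal.ofReal (Q x) ^ (-s) with hf
  have hfle : ∀ {t : ℝ} {x : G}, 0 < t → t ≤ Q x → f x ≤ ENNReal.ofReal (t ^ (-s)) := by
    intro t x ht hx
    rw [hf]
    dsimp only
    rw [ENNReal.ofReal_rpow_of_pos (ht.trans_le hx)]
    exact ENNReal.ofReal_le_ofReal (Real.rpow_le_rpow_of_nonpos ht hx (by linarith))
  have hmeas : ∀ a b, MeasurableSet {x | a ≤ Q x ∧ Q x ≤ b} := fun a b =>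
    ((isClosed_le continuous_const hQc).inter (isClosed_le hQc continuous_const)).measurableSet
  have hH := measure_sublevel_le μ hQc hε hl hsub hstrict
  have hH0 : μ {x | Q x ≤ ε} ≠ ⊤ := (hcomp ε).measure_lt_top.ne
  obtain ⟨M, hM, hann⟩ := exists_measure_annulus_le μ hcomp hl0 hinf
  set Z : Set G := {x | Q x ≤ 0}
  set A : ℕ → Set G := fun j => {x | ε / l ^ (j + 1) ≤ Q x ∧ Q x ≤ ε / l ^ j}
  set B : ℕ → Set G := fun k => {x | ε * l ^ k ≤ Q x ∧ Q x ≤ l * (ε * l ^ k)}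
  -- The integrand is `⊤` on `Z`, so this set has to be null; it lies in all the shrinking sublevel
  -- sets.
  have hZ : μ Z = 0 := by
    have h1 : Tendsto (fun j : ℕ => μ {x | Q x ≤ ε} * (1 / 2 : ENNReal) ^ j) atTop (nhds 0) := by
      have := ENNReal.Tendsto.const_mul (a := μ {x | Q x ≤ ε})
        (ENNReal.tendsto_pow_atTop_nhds_zero_of_lt_one (r := 1 / 2)
          (by rw [one_div]; exact ENNReal.inv_lt_one.2 (by norm_num))) (Or.inr hH0)
      simpa using this
    refine le_antisymm (ge_of_tendsto' h1 fun j => ?_) bot_le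
    exact (measure_mono fun x (hx : Q x ≤ 0) => hx.trans (by positivity)).trans (hH j)
  have hcover : Set.univ ⊆ Z ∪ ((⋃ j, A j) ∪ ⋃ k, B k) := by
    intro x _
    rcases le_or_gt (Q x) 0 with h0 | h0
    · exact Or.inl h0
    right
    rcases le_or_gt (Q x) ε with h1 | h1
    · left
      obtain ⟨n, hn1, hn2⟩ := exists_nat_pow_near (x := ε / Q x) (y := l)
        ((one_le_div h0).2 h1) hl
      refine Set.mem_iUnion.2 ⟨n, ?_, ?_⟩
      · rw [div_le_iff₀ (by positivity), mul_comm, ← div_le_iff₀ h0]; exact hn2.le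
      · rw [le_div_iff₀ (by positivity), mul_comm, ← le_div_iff₀ h0]; exact hn1
    · right
      obtain ⟨n, hn1, hn2⟩ := exists_nat_pow_near (x := Q x / ε) (y := l)
        ((one_le_div hε).2 h1.le) hl
      refine Set.mem_iUnion.2 ⟨n, ?_, ?_⟩
      · rw [mul_comm, ← le_div_iff₀ hε]; exact hn1
      · rw [div_lt_iff₀ hε, pow_succ] at hn2
        nlinarith
  have hA : ∀ j, ∫⁻ x in A j, f x ∂μ ≤
      ENNReal.ofReal ((ε / l) ^ (-s)) * μ {x | Q x ≤ ε} * ENNReal.ofReal (l ^ s / 2) ^ j := by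
    intro j
    have e : (ε / l ^ (j + 1)) ^ (-s) = (ε / l) ^ (-s) * (l ^ s) ^ j := by
      have h : ε / l ^ (j + 1) = ε / l * (l ^ j)⁻¹ := by rw [pow_succ]; field_simp
      have h' : (l ^ j)⁻¹ ^ (-s) = (l ^ j) ^ s := by
        rw [Real.inv_rpow (by positivity), Real.rpow_neg (by positivity), inv_inv]
      rw [h, Real.mul_rpow (by positivity) (by positivity), h', ← Real.rpow_natCast, ← Real.rpow_natCast,
        ← Real.rpow_mul hl0.le, ← Real.rpow_mul hl0.le, mul_comm (j : ℝ)]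
    calc ∫⁻ x in A j, f x ∂μ
        ≤ ∫⁻ x in A j, ENNReal.ofReal ((ε / l ^ (j + 1)) ^ (-s)) ∂μ :=
          setLIntegral_mono' (hmeas _ _) fun x hx => hfle (by positivity) hx.1
      _ = ENNReal.ofReal ((ε / l ^ (j + 1)) ^ (-s)) * μ (A j) := setLIntegral_const _ _
      _ ≤ ENNReal.ofReal ((ε / l ^ (j + 1)) ^ (-s)) * (μ {x | Q x ≤ ε} * (1 / 2) ^ j) := by
          gcongr
          exact (measure_mono fun x hx => hx.2).trans (hH j)
      _ = _ := by
          have h2 : (1 / 2 : ENNReal) = ENNReal.ofReal (1 / 2) := by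
            rw [ENNReal.ofReal_div_of_pos two_pos]; simp
          rw [e, h2, ENNReal.ofReal_mul (by positivity), ENNReal.ofReal_pow (by positivity),
            div_eq_mul_one_div (l ^ s), ENNReal.ofReal_mul (p := l ^ s) (by positivity), mul_pow]
          ring
  have hB : ∀ k, ∫⁻ x in B k, f x ∂μ ≤
      ENNReal.ofReal (ε ^ (-s)) * M * ENNReal.ofReal (l ^ (-s)) ^ k := by
    intro k
    have e : (ε * l ^ k) ^ (-s) = ε ^ (-s) * (l ^ (-s)) ^ k := by
      rw [Real.mul_rpow (by positivity) (by positivity), ← Real.rpow_natCast, ← Real.rpow_natCast,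
        ← Real.rpow_mul hl0.le, ← Real.rpow_mul hl0.le, mul_comm (k : ℝ)]
    calc ∫⁻ x in B k, f x ∂μ
        ≤ ∫⁻ x in B k, ENNReal.ofReal ((ε * l ^ k) ^ (-s)) ∂μ :=
          setLIntegral_mono' (hmeas _ _) fun x hx => hfle (by positivity) hx.1
      _ = ENNReal.ofReal ((ε * l ^ k) ^ (-s)) * μ (B k) := setLIntegral_const _ _
      _ ≤ ENNReal.ofReal ((ε * l ^ k) ^ (-s)) * M := by
          gcongr
          exact hann _
      _ = _ := by
          rw [e, ENNReal.ofReal_mul (by positivity), ENNReal.ofReal_pow (by positivity)]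
          ring
  have hgeom : ∀ (K : ENNReal) (r : ℝ), K ≠ ⊤ → r < 1 →
      ∑' j : ℕ, K * ENNReal.ofReal r ^ j ≠ ⊤ := by
    intro K r hK hr
    rw [ENNReal.tsum_mul_left, ENNReal.tsum_geometric]
    refine ENNReal.mul_ne_top hK (ENNReal.inv_ne_top.2 ?_)
    rw [Ne, tsub_eq_zero_iff_le, not_le]
    exact ENNReal.ofReal_lt_one.2 hr
  calc ∫⁻ x, f x ∂μ = ∫⁻ x in Set.univ, f x ∂μ := (setLIntegral_univ f).symm
    _ ≤ ∫⁻ x in Z ∪ ((⋃ j, A j) ∪ ⋃ k, B k), f x ∂μ := lintegral_mono_set hcover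
    _ ≤ ∫⁻ x in Z, f x ∂μ + ∫⁻ x in (⋃ j, A j) ∪ ⋃ k, B k, f x ∂μ := lintegral_union_le _ _ _
    _ ≤ 0 + (∑' j, ∫⁻ x in A j, f x ∂μ + ∑' k, ∫⁻ x in B k, f x ∂μ) := by
        gcongr
        · exact (setLIntegral_measure_zero _ _ hZ).le
        · exact (lintegral_union_le _ _ _).trans
            (add_le_add (lintegral_iUnion_le _ _) (lintegral_iUnion_le _ _))
    _ ≤ 0 + ((∑' j : ℕ, ENNReal.ofReal ((ε / l) ^ (-s)) * μ {x | Q x ≤ ε} *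
          ENNReal.ofReal (l ^ s / 2) ^ j) +
          ∑' k : ℕ, ENNReal.ofReal (ε ^ (-s)) * M * ENNReal.ofReal (l ^ (-s)) ^ k) := by
        gcongr with j k
        · exact hA j
        · exact hB k
    _ < ⊤ := by
        rw [zero_add, lt_top_iff_ne_top, ENNReal.add_ne_top]
        exact ⟨hgeom _ _ (ENNReal.mul_ne_top ENNReal.ofReal_ne_top hH0) (by linarith),
          hgeom _ _ (ENNReal.mul_ne_top ENNReal.ofReal_ne_top hM) hls'⟩

end Integral

/-! ### Coordinates on the torus and its scalars -/

section TorusCoordinates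

variable {F : Type*} [Field F] {D : F}

theorem torus_apply_one_one (e : torus D) : (e : GL2 F) 1 1 = (e : GL2 F) 0 0 := by
  obtain ⟨a, b, h⟩ := (mem_torus_iff D e).1 e.2
  simp [h]

theorem torus_apply_one_zero (e : torus D) : (e : GL2 F) 1 0 = (e : GL2 F) 0 1 * D := by
  obtain ⟨a, b, h⟩ := (mem_torus_iff D e).1 e.2
  simp [h]

theorem torus_det (e : torus D) : ((e : GL2 F) : Matrix (Fin 2) (Fin 2) F).det =
    (e : GL2 F) 0 0 ^ 2 - (e : GL2 F) 0 1 ^ 2 * D := by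
  rw [Matrix.det_fin_two, torus_apply_one_one, torus_apply_one_zero]
  ring

theorem torus_det_ne_zero (e : torus D) :
    ((e : GL2 F) : Matrix (Fin 2) (Fin 2) F).det ≠ 0 :=
  (Matrix.GeneralLinearGroup.det (e : GL2 F)).ne_zero

theorem torus_mul_apply_zero_one (e f : torus D) : ((e * f : torus D) : GL2 F) 0 1 =
    (e : GL2 F) 0 0 * (f : GL2 F) 0 1 + (e : GL2 F) 0 1 * (f : GL2 F) 0 0 := by
  rw [Subgroup.coe_mul, Units.val_mul, Matrix.mul_apply, Fin.sum_univ_two, torus_apply_one_one]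

theorem torus_inv_mul_apply_zero_one (e f : torus D) : ((e⁻¹ * f : torus D) : GL2 F) 0 1 =
    ((e : GL2 F) 0 0 * (f : GL2 F) 0 1 - (e : GL2 F) 0 1 * (f : GL2 F) 0 0) /
      ((e : GL2 F) : Matrix (Fin 2) (Fin 2) F).det := by
  rw [Subgroup.coe_mul, Subgroup.coe_inv, Units.val_mul, Matrix.coe_units_inv, Matrix.inv_def,
    Matrix.adjugate_fin_two, Ring.inverse_eq_inv', Matrix.mul_apply, Fin.sum_univ_two,
    torus_apply_one_one f, torus_apply_one_one e]
  simp
  ring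

/-- The element `a + b √D` of the torus. -/
def torusMk (D a b : F) (h : a ^ 2 - b ^ 2 * D ≠ 0) : torus D :=
  ⟨{ val := !![a, b; b * D, a]
     inv := !![a / (a ^ 2 - b ^ 2 * D), -b / (a ^ 2 - b ^ 2 * D);
        -(b * D) / (a ^ 2 - b ^ 2 * D), a / (a ^ 2 - b ^ 2 * D)]
     val_inv := by
        ext i j; fin_cases i <;> fin_cases j <;> simp <;> field_simp <;> ring
     inv_val := by
        ext i j; fin_cases i <;> fin_cases j <;> simp <;> field_simp <;> ring },
    (mem_torus_iff D _).2 ⟨a, b, rfl⟩⟩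

/-- Commuting with `upperUnip 1` forces the lower-left entry `b D` to vanish, and `D ≠ 0` then gives
`b = 0`. -/
theorem apply_zero_one_of_mem_scalars (hD : D ≠ 0) {z : torus D} (hz : z ∈ scalarsInTorus D) :
    (z : GL2 F) 0 1 = 0 := by
  have h := Subgroup.mem_center_iff.1 (Subgroup.mem_subgroupOf.1 hz) (upperUnip 1)
  have h1 := congrArg (fun g : GL2 F => g 0 0) h
  simp only [Units.val_mul, Matrix.mul_apply, Fin.sum_univ_two] at h1
  simp [upperUnip, torus_apply_one_zero, hD] at h1
  exact h1

theorem mem_scalars_of_apply_zero_one {z : torus D} (hz : (z : GL2 F) 0 1 = 0) :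
    z ∈ scalarsInTorus D := by
  rw [Subgroup.mem_subgroupOf, Subgroup.mem_center_iff]
  intro g
  have h10 := torus_apply_one_zero z
  have h11 := torus_apply_one_one z
  rw [hz, zero_mul] at h10
  ext i j
  fin_cases i <;> fin_cases j <;>
    simp [Matrix.mul_apply, Fin.sum_univ_two, hz, h10, h11, mul_comm]

/-- Elements of the torus with proportional coordinates agree modulo scalars. -/
theorem mk_torusMk_div_eq (e : torus D) (s : F)
    (h : ((e : GL2 F) 0 0 / s) ^ 2 - ((e : GL2 F) 0 1 / s) ^ 2 * D ≠ 0) :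
    (QuotientGroup.mk (torusMk D _ _ h) : TorusModScalars D) = QuotientGroup.mk e := by
  refine (QuotientGroup.eq.2 (mem_scalars_of_apply_zero_one ?_)).symm
  rw [torus_inv_mul_apply_zero_one]
  simp [torusMk]
  left
  ring

end TorusCoordinates

/-! ### The proper function `|b|² / |N(e)|` -/

section TorusRatio

variable {F : Type*} [Field F] [ValuativeRel F] [TopologicalSpace F] [IsNonarchimedeanLocalField F]
  {D : F}

/-- The ratio `|b|² / |N(e)|` for `e = a + b √D`. -/
noncomputable def ratio (e : torus D) : ℝ :=
  vabs F ((e : GL2 F) 0 1) ^ 2 / vabs F ((e : GL2 F) : Matrix (Fin 2) (Fin 2) F).det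

theorem ratio_nonneg (e : torus D) : 0 ≤ ratio e :=
  div_nonneg (sq_nonneg _) (vabs_nonneg _)

theorem ratio_mul_scalar (hD : D ≠ 0) (e : torus D) {z : torus D} (hz : z ∈ scalarsInTorus D) :
    ratio (e * z) = ratio e := by
  have h := apply_zero_one_of_mem_scalars hD hz
  have hdz : ((z : GL2 F) : Matrix (Fin 2) (Fin 2) F).det = (z : GL2 F) 0 0 ^ 2 := by
    rw [torus_det, h]; ring
  have hz0 : (z : GL2 F) 0 0 ≠ 0 := by
    intro h0
    apply torus_det_ne_zero z
    rw [hdz, h0]; ring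
  have := vabs_pos hz0
  have := vabs_pos (torus_det_ne_zero e)
  unfold ratio
  rw [torus_mul_apply_zero_one, h, Subgroup.coe_mul, Units.val_mul, Matrix.det_mul, hdz]
  simp only [mul_zero, zero_add, map_mul, map_pow]
  field_simp

/-- The function on `F^× \ E^×` induced by `ratio`. -/
noncomputable def quotientRatio (x : TorusModScalars D) : ℝ := ratio (Quotient.out x : torus D)

theorem quotientRatio_mk (hD : D ≠ 0) (e : torus D) :
    quotientRatio (QuotientGroup.mk e : TorusModScalars D) = ratio e := by
  obtain ⟨z, hz⟩ := QuotientGroup.mk_out_eq_mul (scalarsInTorus D) e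
  have hout : (Quotient.out (QuotientGroup.mk e : TorusModScalars D)) = e * (z : torus D) := hz
  unfold quotientRatio
  rw [hout, ratio_mul_scalar hD e z.2]

theorem ratio_mul (e f : torus D) : ratio (e * f) =
    vabs F ((e : GL2 F) 0 0 * (f : GL2 F) 0 1 + (e : GL2 F) 0 1 * (f : GL2 F) 0 0) ^ 2 /
      (vabs F ((e : GL2 F) : Matrix (Fin 2) (Fin 2) F).det *
        vabs F ((f : GL2 F) : Matrix (Fin 2) (Fin 2) F).det) := by
  rw [ratio, torus_mul_apply_zero_one, Subgroup.coe_mul, Units.val_mul, Matrix.det_mul, map_mul]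

theorem ratio_inv_mul (e f : torus D) : ratio (e⁻¹ * f) =
    vabs F ((e : GL2 F) 0 0 * (f : GL2 F) 0 1 - (e : GL2 F) 0 1 * (f : GL2 F) 0 0) ^ 2 /
      (vabs F ((e : GL2 F) : Matrix (Fin 2) (Fin 2) F).det *
        vabs F ((f : GL2 F) : Matrix (Fin 2) (Fin 2) F).det) := by
  have he := vabs_pos (torus_det_ne_zero e)
  have hf := vabs_pos (torus_det_ne_zero f)
  have h1 : (((e⁻¹ : torus D) : GL2 F) : Matrix (Fin 2) (Fin 2) F).det =
      ((e : GL2 F) : Matrix (Fin 2) (Fin 2) F).det⁻¹ := by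
    rw [Subgroup.coe_inv, Matrix.coe_units_inv, Matrix.det_nonsing_inv, Ring.inverse_eq_inv']
  rw [ratio, torus_inv_mul_apply_zero_one, Subgroup.coe_mul, Units.val_mul, Matrix.det_mul, map_mul,
    h1, map_inv₀, map_div₀]
  field_simp

/-- Near the identity, the sublevel sets of `ratio` are subgroups. -/
theorem ratio_inv_mul_le {d : ℝ} (hdD : d * vabs F D < 1) {e f : torus D}
    (he : ratio e ≤ d) (hf : ratio f ≤ d) : ratio (e⁻¹ * f) ≤ d := by
  -- Here `|b² D| < |N|`, so `a² = N + b² D` gives `|a|² = |N|`. Both terms of `a b' - b a'` then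
  -- have squared absolute value at most `d |N| |N'|`.
  have key : ∀ e : torus D, ratio e ≤ d → vabs F ((e : GL2 F) 0 0) ^ 2 =
      vabs F ((e : GL2 F) : Matrix (Fin 2) (Fin 2) F).det := by
    intro e he
    have hN := vabs_pos (torus_det_ne_zero e)
    rw [ratio, div_le_iff₀ hN] at he
    have h : (e : GL2 F) 0 0 ^ 2 = ((e : GL2 F) : Matrix (Fin 2) (Fin 2) F).det +
        (e : GL2 F) 0 1 ^ 2 * D := by
      rw [torus_det]; ring
    rw [← map_pow, h, vabs_add_eq_left]
    rw [map_mul, map_pow]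
    nlinarith [vabs_nonneg D]
  have hNe := vabs_pos (torus_det_ne_zero e)
  have hNf := vabs_pos (torus_det_ne_zero f)
  have hke := key e he
  have hkf := key f hf
  have hd0 : 0 ≤ d := (ratio_nonneg e).trans he
  rw [ratio_inv_mul, div_le_iff₀ (by positivity)]
  rw [ratio, div_le_iff₀ hNe] at he
  rw [ratio, div_le_iff₀ hNf] at hf
  have hmax := vabs_sub_le (x := (e : GL2 F) 0 0 * (f : GL2 F) 0 1)
    (y := (e : GL2 F) 0 1 * (f : GL2 F) 0 0)
    (r := Real.sqrt (d * (vabs F ((e : GL2 F) : Matrix (Fin 2) (Fin 2) F).det *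
        vabs F ((f : GL2 F) : Matrix (Fin 2) (Fin 2) F).det)))
    (by
      apply Real.le_sqrt_of_sq_le
      rw [map_mul, mul_pow, hke]
      nlinarith)
    (by
      apply Real.le_sqrt_of_sq_le
      rw [map_mul, mul_pow, hkf]
      nlinarith)
  have := pow_le_pow_left₀ (vabs_nonneg _) hmax 2
  rwa [Real.sq_sqrt (by positivity)] at this

/-- Far out, elements of the torus with comparable `ratio` are comparable up to conjugation. -/
theorem ratio_inv_mul_le_or_ratio_mul_le (h2 : (2 : F) ≠ 0) (hD : D ≠ 0) {l t : ℝ}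
    (ht : 2 / vabs F D ≤ t) {e f : torus D} (he : t ≤ ratio e) (he' : ratio e ≤ l * t)
    (hf : t ≤ ratio f) (hf' : ratio f ≤ l * t) :
    ratio (e⁻¹ * f) ≤ l ^ 2 / (vabs F 2 ^ 2 * vabs F D) ∨
      ratio (e * f) ≤ l ^ 2 / (vabs F 2 ^ 2 * vabs F D) := by
  have hD0 := vabs_pos hD
  have h20 := vabs_pos h2
  have ht0 : 0 < t := lt_of_lt_of_le (by positivity) ht
  have hNe := vabs_pos (torus_det_ne_zero e)
  have hNf := vabs_pos (torus_det_ne_zero f)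
  set N := ((e : GL2 F) : Matrix (Fin 2) (Fin 2) F).det with hN
  set N' := ((f : GL2 F) : Matrix (Fin 2) (Fin 2) F).det with hN'
  set a := (e : GL2 F) 0 0 with ha
  set b := (e : GL2 F) 0 1 with hb
  set a' := (f : GL2 F) 0 0 with ha'
  set b' := (f : GL2 F) 0 1 with hb'
  have hNeq : N = a ^ 2 - b ^ 2 * D := torus_det e
  have hNeq' : N' = a' ^ 2 - b' ^ 2 * D := torus_det f
  have hre : ratio e = vabs F b ^ 2 / vabs F N := rfl
  have hrf : ratio f = vabs F b' ^ 2 / vabs F N' := rfl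
  have hl0 : 0 ≤ l * t := (ratio_nonneg e).trans he'
  rw [hre] at he he'
  rw [hrf] at hf hf'
  rw [ratio_inv_mul, ratio_mul]
  rw [div_le_iff₀ hNe] at he'
  rw [div_le_iff₀ hNf] at hf'
  rw [le_div_iff₀ hNe] at he
  rw [le_div_iff₀ hNf] at hf
  -- The factor `2` in `2 / |D| ≤ t` makes `|N| < |b² D|` strict, so here `b² D` dominates `N` in
  -- `a² = b² D + N`.
  have ha2 : vabs F a ^ 2 = vabs F b ^ 2 * vabs F D := by
    have h : a ^ 2 = b ^ 2 * D + N := by rw [hNeq]; ring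
    rw [← map_pow, h, vabs_add_eq_left, map_mul, map_pow]
    rw [map_mul, map_pow]
    rw [div_le_iff₀ hD0] at ht
    nlinarith
  -- `X / N` and `Y` are the `√D`-coordinates of `e⁻¹ f` and `e f`. The product `X Y = N b'² - N'
  -- b²` is small while the sum `X + Y = 2 a b'` is large; so one of them is large and the other is
  -- forced to be small.
  set X := a * b' - b * a' with hX
  set Y := a * b' + b * a' with hY
  have hXY : vabs F X * vabs F Y ≤ l * t * (vabs F N * vabs F N') := by
    have h : X * Y = N * b' ^ 2 - N' * b ^ 2 := by rw [hX, hY, hNeq, hNeq']; ring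
    rw [← map_mul, h]
    refine vabs_sub_le ?_ ?_ <;> rw [map_mul, map_pow] <;> nlinarith
  have hsum : X + Y = 2 * (a * b') := by rw [hX, hY]; ring
  have hbig : vabs F 2 ^ 2 * vabs F D * t ^ 2 * (vabs F N * vabs F N') ≤
      max (vabs F X ^ 2) (vabs F Y ^ 2) := by
    have h1 : vabs F (X + Y) ^ 2 ≤ max (vabs F X ^ 2) (vabs F Y ^ 2) := by
      rcases le_max_iff.1 (vabs_add_le_max X Y) with h | h
      · exact (pow_le_pow_left₀ (vabs_nonneg _) h 2).trans (le_max_left _ _)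
      · exact (pow_le_pow_left₀ (vabs_nonneg _) h 2).trans (le_max_right _ _)
    refine le_trans ?_ h1
    rw [hsum, map_mul, map_mul, mul_pow, mul_pow, ha2]
    have h3 : t * vabs F N * (t * vabs F N') ≤ vabs F b ^ 2 * vabs F b' ^ 2 :=
      mul_le_mul he hf (by positivity) (by positivity)
    have h4 := mul_le_mul_of_nonneg_left h3 (show 0 ≤ vabs F 2 ^ 2 * vabs F D by positivity)
    nlinarith
  have hfinal : ∀ x y : ℝ, 0 ≤ x → 0 ≤ y → x * y ≤ l * t * (vabs F N * vabs F N') →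
      vabs F 2 ^ 2 * vabs F D * t ^ 2 * (vabs F N * vabs F N') ≤ y ^ 2 →
      x ^ 2 / (vabs F N * vabs F N') ≤ l ^ 2 / (vabs F 2 ^ 2 * vabs F D) := by
    intro x y hx hy hxy hyy
    have hy0 : 0 < y ^ 2 := lt_of_lt_of_le (by positivity) hyy
    rw [div_le_div_iff₀ (by positivity) (by positivity)]
    have h5 : (x * y) ^ 2 ≤ (l * t * (vabs F N * vabs F N')) ^ 2 :=
      pow_le_pow_left₀ (mul_nonneg hx hy) hxy 2
    have h6 : x ^ 2 * (vabs F 2 ^ 2 * vabs F D * t ^ 2 * (vabs F N * vabs F N')) ≤ (x * y) ^ 2 := by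
      rw [mul_pow]
      exact mul_le_mul_of_nonneg_left hyy (sq_nonneg x)
    have h7 : (t ^ 2 * (vabs F N * vabs F N')) * (x ^ 2 * (vabs F 2 ^ 2 * vabs F D)) ≤
        (t ^ 2 * (vabs F N * vabs F N')) * (l ^ 2 * (vabs F N * vabs F N')) := by
      calc _ = x ^ 2 * (vabs F 2 ^ 2 * vabs F D * t ^ 2 * (vabs F N * vabs F N')) := by ring
        _ ≤ _ := h6.trans h5
        _ = _ := by ring
    exact le_of_mul_le_mul_left h7 (by positivity)
  rcases le_max_iff.1 hbig with h | h
  · right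
    exact hfinal _ _ (vabs_nonneg _) (vabs_nonneg _) (by rwa [mul_comm]) h
  · left
    exact hfinal _ _ (vabs_nonneg _) (vabs_nonneg _) hXY h

theorem continuous_ratio : Continuous (ratio : torus D → ℝ) := by
  have hc : Continuous fun e : torus D => ((e : GL2 F) : Matrix (Fin 2) (Fin 2) F) :=
    Units.continuous_val.comp continuous_subtype_val
  exact ((continuous_vabs.comp (hc.matrix_elem 0 1)).pow 2).div
    (continuous_vabs.comp hc.matrix_det) fun e => (vabs_pos (torus_det_ne_zero e)).ne'

theorem continuous_quotientRatio (hD : D ≠ 0) :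
    Continuous (quotientRatio : TorusModScalars D → ℝ) := by
  rw [(QuotientGroup.isQuotientMap_mk (N := scalarsInTorus D)).continuous_iff]
  exact continuous_ratio.congr fun e => (quotientRatio_mk hD e).symm

theorem continuous_torusMk {S : Set (F × F)} (hS : ∀ p ∈ S, p.1 ^ 2 - p.2 ^ 2 * D ≠ 0) :
    Continuous fun p : S => torusMk D (p : F × F).1 (p : F × F).2 (hS p p.2) := by
  have h1 : Continuous fun p : S => (p : F × F).1 := continuous_fst.comp continuous_subtype_val
  have h2 : Continuous fun p : S => (p : F × F).2 := continuous_snd.comp continuous_subtype_val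
  have h3 : Continuous fun p : S => ((p : F × F).1 ^ 2 - (p : F × F).2 ^ 2 * D)⁻¹ :=
    Continuous.inv₀ (by fun_prop) fun p => hS p p.2
  refine Continuous.subtype_mk (Units.continuous_iff.2 ⟨?_, ?_⟩) _
  · refine continuous_matrix fun i j => ?_
    fin_cases i <;> fin_cases j <;> simp <;> fun_prop
  · refine continuous_matrix fun i j => ?_
    fin_cases i <;> fin_cases j <;> simp [div_eq_mul_inv] <;> fun_prop

/-- Modulo scalars, `(a, b)` can be divided by its larger coordinate. A bound on `ratio` keeps the
rescaled norm away from `0`, so the sublevel set is closed in the image of a compact subset `S` of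
`𝒪 × 𝒪`. The constant `M` is chosen so that `|a|²` and `|b|²` are at most `M |N|`. -/
theorem isCompact_quotientRatio_le (hD : D ≠ 0) (R : ℝ) :
    IsCompact {x : TorusModScalars D | quotientRatio x ≤ R} := by
  set M : ℝ := max 1 (max R (R * vabs F D)) with hM
  have hM0 : 0 < M := lt_of_lt_of_le one_pos (le_max_left _ _)
  set S : Set (F × F) := ({x : F | vabs F x ≤ 1} ×ˢ {x : F | vabs F x ≤ 1}) ∩
    {p | M⁻¹ ≤ vabs F (p.1 ^ 2 - p.2 ^ 2 * D)} with hS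
  have hSc : IsCompact S := by
    refine (isCompact_vabs_le_one.prod isCompact_vabs_le_one).inter_right ?_
    exact isClosed_le continuous_const (continuous_vabs.comp (by fun_prop))
  have hS0 : ∀ p ∈ S, p.1 ^ 2 - p.2 ^ 2 * D ≠ 0 := by
    intro p hp h0
    have h : M⁻¹ ≤ vabs F (p.1 ^ 2 - p.2 ^ 2 * D) := hp.2
    rw [h0, map_zero] at h
    exact absurd (inv_pos.2 hM0) (not_lt.2 h)
  have : CompactSpace S := isCompact_iff_compactSpace.1 hSc
  have hK : IsCompact (Set.range fun p : S =>
      (QuotientGroup.mk (torusMk D (p : F × F).1 (p : F × F).2 (hS0 p p.2)) : TorusModScalars D)) :=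
    isCompact_range (continuous_quotient_mk'.comp (continuous_torusMk hS0))
  refine hK.of_isClosed_subset (isClosed_le (continuous_quotientRatio hD) continuous_const) ?_
  intro x hx
  obtain ⟨e, rfl⟩ := QuotientGroup.mk_surjective x
  rw [Set.mem_ofPred_eq, quotientRatio_mk hD] at hx
  have hN0 := torus_det_ne_zero e
  have hN := vabs_pos hN0
  rw [ratio, div_le_iff₀ hN] at hx
  have hdet := torus_det e
  set N := ((e : GL2 F) : Matrix (Fin 2) (Fin 2) F).det
  set a := (e : GL2 F) 0 0
  set b := (e : GL2 F) 0 1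
  have hb : vabs F b ^ 2 ≤ M * vabs F N :=
    hx.trans (mul_le_mul_of_nonneg_right ((le_max_left _ _).trans (le_max_right _ _)) hN.le)
  have ha : vabs F a ^ 2 ≤ M * vabs F N := by
    have h : a ^ 2 = N + b ^ 2 * D := by rw [hdet]; ring
    rw [← map_pow, h]
    refine vabs_add_le ?_ ?_
    · nlinarith [le_max_left 1 (max R (R * vabs F D))]
    · rw [map_mul, map_pow]
      calc vabs F b ^ 2 * vabs F D ≤ R * vabs F N * vabs F D :=
            mul_le_mul_of_nonneg_right hx (vabs_nonneg D)
        _ = (R * vabs F D) * vabs F N := by ring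
        _ ≤ M * vabs F N := mul_le_mul_of_nonneg_right
            ((le_max_right _ _).trans (le_max_right _ _)) hN.le
  have key : ∀ s : F, s ≠ 0 → vabs F a ≤ vabs F s → vabs F b ≤ vabs F s →
      vabs F s ^ 2 ≤ M * vabs F N → (a / s, b / s) ∈ S := by
    intro s hs has hbs hsN
    have hs' := vabs_pos hs
    refine ⟨⟨?_, ?_⟩, ?_⟩
    · change vabs F (a / s) ≤ 1
      rw [map_div₀]; exact div_le_one_of_le₀ has hs'.le
    · change vabs F (b / s) ≤ 1
      rw [map_div₀]; exact div_le_one_of_le₀ hbs hs'.le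
    · change M⁻¹ ≤ vabs F ((a / s) ^ 2 - (b / s) ^ 2 * D)
      have h : (a / s) ^ 2 - (b / s) ^ 2 * D = N / s ^ 2 := by rw [hdet]; field_simp
      rw [h, map_div₀, map_pow, le_div_iff₀ (by positivity), inv_mul_le_iff₀ hM0]
      exact hsN
  have hab : a ≠ 0 ∨ b ≠ 0 := by
    by_contra! h
    apply hN0
    rw [hdet, h.1, h.2]; ring
  obtain ⟨s, hs⟩ : ∃ s : F, (a / s, b / s) ∈ S := by
    rcases le_total (vabs F a) (vabs F b) with h | h
    · refine ⟨b, key b (fun h0 => ?_) h le_rfl hb⟩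
      rw [h0, map_zero] at h
      exact hab.elim (fun h1 => h1 ((map_eq_zero (vabs F)).1 (le_antisymm h (vabs_nonneg _))))
        fun h1 => h1 h0
    · refine ⟨a, key a (fun h0 => ?_) le_rfl h ha⟩
      rw [h0, map_zero] at h
      exact hab.elim (fun h1 => h1 h0)
        fun h1 => h1 ((map_eq_zero (vabs F)).1 (le_antisymm h (vabs_nonneg _)))
  exact ⟨⟨_, hs⟩, mk_torusMk_div_eq e s (hS0 _ hs)⟩

/-- Small powers of `|N(e)| / |b|²` are integrable on `F^× \ E^×`. -/
theorem exists_lintegral_quotientRatio_lt_top (h2 : (2 : F) ≠ 0) (hD : D ≠ 0)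
    [MeasurableSpace (TorusModScalars D)] [BorelSpace (TorusModScalars D)]
    (μ : Measure (TorusModScalars D)) [μ.IsHaarMeasure] :
    ∃ s₀ : ℝ, 0 < s₀ ∧ ∀ s, 0 < s → s ≤ s₀ →
      ∫⁻ x, ENNReal.ofReal (quotientRatio x) ^ (-s) ∂μ < ⊤ := by
  obtain ⟨p, hp⟩ := IsDiscreteValuationRing.exists_irreducible 𝒪[F]
  obtain ⟨hω0, hω1⟩ := vabs_irreducible hp
  have hD0 := vabs_pos hD
  obtain ⟨m, hm⟩ := exists_pow_lt_of_lt_one (inv_pos.2 hD0) (pow_lt_one₀ hω0.le hω1 two_ne_zero)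
  have hε : 0 < (vabs F (p : F) ^ 2) ^ m := by positivity
  have hεD : (vabs F (p : F) ^ 2) ^ m * vabs F D < 1 := by
    rwa [lt_inv_comm₀ hε hD0, ← one_div, lt_div_iff₀ hε, mul_comm] at hm
  have hl : 1 < (vabs F (p : F) ^ 2)⁻¹ :=
    (one_lt_inv₀ (by positivity)).2 (pow_lt_one₀ hω0.le hω1 two_ne_zero)
  refine exists_lintegral_rpow_neg_lt_top μ (continuous_quotientRatio hD)
    (isCompact_quotientRatio_le hD) (R₀ := 2 / vabs F D)
    (R := (vabs F (p : F) ^ 2)⁻¹ ^ 2 / (vabs F 2 ^ 2 * vabs F D)) hε hl ?_ ?_ ?_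
  · intro d hd x y hx hy
    obtain ⟨e, rfl⟩ := QuotientGroup.mk_surjective x
    obtain ⟨f, rfl⟩ := QuotientGroup.mk_surjective y
    rw [quotientRatio_mk hD] at hx hy
    rw [← QuotientGroup.mk_inv, ← QuotientGroup.mk_mul, quotientRatio_mk hD]
    exact ratio_inv_mul_le (lt_of_le_of_lt (mul_le_mul_of_nonneg_right hd hD0.le) hεD) hx hy
  · intro j
    -- With `ε = |p|^(2m)` and `l = |p|⁻²`, the element `1 + p^(m+j) √D` has norm of absolute value
    -- `1` and ratio exactly `ε / l ^ j`.
    set b : F := (p : F) ^ (m + j) with hb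
    have hvb : vabs F b ^ 2 = (vabs F (p : F) ^ 2) ^ m / ((vabs F (p : F) ^ 2)⁻¹) ^ j := by
      rw [hb, map_pow, inv_pow, div_inv_eq_mul, ← pow_add, ← pow_mul, ← pow_mul, mul_comm]
    have hlt : vabs F (b ^ 2 * D) < 1 := by
      rw [map_mul, map_pow, hvb]
      refine lt_of_le_of_lt (mul_le_mul_of_nonneg_right ?_ hD0.le) hεD
      exact div_le_self hε.le (one_le_pow₀ hl.le)
    have hone : vabs F (1 ^ 2 - b ^ 2 * D) = 1 := by
      rw [one_pow, vabs_sub_eq_left, map_one]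
      rwa [map_one]
    have hne : (1 : F) ^ 2 - b ^ 2 * D ≠ 0 := by
      intro h
      rw [h, map_zero] at hone
      exact zero_ne_one hone
    have hr : ratio (torusMk D 1 b hne) = vabs F b ^ 2 := by
      rw [ratio, torus_det]
      change vabs F b ^ 2 / vabs F (1 ^ 2 - b ^ 2 * D) = _
      rw [hone, div_one]
    refine ⟨QuotientGroup.mk (torusMk D 1 b hne), ?_, ?_⟩
    · rw [quotientRatio_mk hD, hr, hvb]
    · rw [quotientRatio_mk hD, hr, hvb]
      exact div_lt_div_of_pos_left hε (by positivity) (pow_lt_pow_right₀ hl j.lt_succ_self)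
  · intro t x y ht hx hx' hy hy'
    obtain ⟨e, rfl⟩ := QuotientGroup.mk_surjective x
    obtain ⟨f, rfl⟩ := QuotientGroup.mk_surjective y
    rw [quotientRatio_mk hD] at hx hx' hy hy'
    rw [← QuotientGroup.mk_inv, ← QuotientGroup.mk_mul, ← QuotientGroup.mk_mul,
      quotientRatio_mk hD, quotientRatio_mk hD]
    exact ratio_inv_mul_le_or_ratio_mul_le h2 hD ht hx hx' hy hy'

end TorusRatio

/-! ### Reduction to a unitary twist -/

section AbsoluteCharacter

variable {F : Type*} [Field F]

/-- The absolute value of a complex character. -/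
noncomputable def absChar (χ : Fˣ →* ℂˣ) : Fˣ →* ℂˣ where
  toFun u := Units.mk0 (‖(χ u : ℂ)‖ : ℂ) (by simp)
  map_one' := by ext; simp
  map_mul' u v := by ext; simp

@[simp] theorem absChar_apply (χ : Fˣ →* ℂˣ) (u : Fˣ) : (absChar χ u : ℂ) = ‖(χ u : ℂ)‖ := rfl

variable {V : Type*}

theorem twist_apply [AddCommGroup V] [Module ℂ V] (χ : Fˣ →* ℂˣ) (π : Representation ℂ (GL2 F) V)
    (g : GL2 F) (v : V) :
    twist χ π g v = (χ (Matrix.GeneralLinearGroup.det g) : ℂ) • π g v := rfl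

variable [NormedAddCommGroup V] [InnerProductSpace ℂ V] {π : Representation ℂ (GL2 F) V}
  {χ : Fˣ →* ℂˣ}

/-- Invariance of the inner product sees `χ` only through `|χ|²`. The gain is that `|χ|` is trivial
on `𝒪^×` once `χ` is unitary there, so `π` and this twist have the same vectors fixed by congruence
subgroups. -/
theorem IsUnitaryRep.twist_absChar (h : IsUnitaryRep (twist χ π)) :
    IsUnitaryRep (twist (absChar χ) π) := by
  intro g v w
  rw [← h g v w]
  simp only [twist_apply, inner_smul_left, inner_smul_right, absChar_apply, Complex.conj_ofReal]
  rw [← mul_assoc, ← mul_assoc, Complex.mul_conj, Complex.normSq_eq_norm_sq]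
  push_cast
  ring

end AbsoluteCharacter

section UnitaryTwist

variable {F : Type*} [Field F] [ValuativeRel F] [TopologicalSpace F] [IsNonarchimedeanLocalField F]
  {V : Type*} [NormedAddCommGroup V] [InnerProductSpace ℂ V] {π : Representation ℂ (GL2 F) V}
  {χ : Fˣ →* ℂˣ}

/-- A character that makes a representation with a newform unitary is unitary on `𝒪^×`. -/
theorem norm_char_eq_one_of_isNewform (hπχ : IsUnitaryRep (twist χ π)) {φ : V}
    (hφ : IsNewform π φ) {u : Fˣ} (hu : vabs F u = 1) : ‖(χ u : ℂ)‖ = 1 := by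
  obtain ⟨hφ0, c, hc, -⟩ := hφ
  have hu' : vabs F ((u⁻¹ : Fˣ) : F) = 1 := by
    rw [Units.val_inv_eq_inv_val, map_inv₀, hu, inv_one]
  let uO : 𝒪[F] := ⟨u, vabs_le_one_iff.1 hu.le⟩
  let uO' : 𝒪[F] := ⟨((u⁻¹ : Fˣ) : F), vabs_le_one_iff.1 hu'.le⟩
  have h1 : uO * uO' = 1 := Subtype.ext (Units.mul_inv u)
  have h2 : uO' * uO = 1 := Subtype.ext (Units.inv_mul u)
  -- The matrix `diag(u, 1)` lies in `K₁(𝔭^c)` for every `c`, so it fixes the newform and the twist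
  -- multiplies that vector by `χ u`.
  let k : Matrix.GeneralLinearGroup (Fin 2) 𝒪[F] :=
    { val := !![uO, 0; 0, 1]
      inv := !![uO', 0; 0, 1]
      val_inv := by ext i j; fin_cases i <;> fin_cases j <;> simp [h1]
      inv_val := by ext i j; fin_cases i <;> fin_cases j <;> simp [h2] }
  have hk : Matrix.GeneralLinearGroup.map (algebraMap 𝒪[F] F) k = diagOne u := by
    ext i j
    fin_cases i <;> fin_cases j <;> simp [k, diagOne]
    rfl
  have hfix := hc k (by simp [k]) (by simp [k])
  rw [hk] at hfix
  have hdet : Matrix.GeneralLinearGroup.det (diagOne u) = u :=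
    Units.ext (by simp [diagOne, Matrix.det_fin_two_of])
  have h := hπχ.norm_apply (diagOne u) φ
  rw [twist_apply, hfix, hdet, norm_smul] at h
  exact mul_right_cancel₀ (norm_ne_zero_iff.2 hφ0) (h.trans (one_mul _).symm)

theorem twist_absChar_apply_of_mem_congruence (hχ : ∀ u : Fˣ, vabs F u = 1 → ‖(χ u : ℂ)‖ = 1)
    {r : ℝ} {hr0 : 0 < r} {hr1 : r ≤ 1} {k : GL2 F} (hk : k ∈ congruence r hr0 hr1) (v : V) :
    twist (absChar χ) π k v = π k v := by
  rw [twist_apply, absChar_apply, hχ _ hk.2, Complex.ofReal_one, one_smul]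

theorem finiteDimensional_fixedVectors_twist (hadm : IsAdmissible π)
    (hχ : ∀ u : Fˣ, vabs F u = 1 → ‖(χ u : ℂ)‖ = 1) (r : ℝ) (hr0 : 0 < r) (hr1 : r ≤ 1) :
    FiniteDimensional ℂ (fixedVectors (twist (absChar χ) π) (congruence r hr0 hr1)) := by
  obtain ⟨W, hW, h⟩ := hadm.2 (congruence r hr0 hr1) isOpen_congruence
  refine Submodule.finiteDimensional_of_le (S₂ := W) fun v hv => h v fun k hk => ?_
  rw [← twist_absChar_apply_of_mem_congruence hχ hk]
  exact hv k hk

theorem exists_mem_fixedVectors_twist (hadm : IsAdmissible π)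
    (hχ : ∀ u : Fˣ, vabs F u = 1 → ‖(χ u : ℂ)‖ = 1) (v : V) :
    ∃ (r : ℝ) (hr0 : 0 < r) (hr1 : r < 1),
      v ∈ fixedVectors (twist (absChar χ) π) (congruence r hr0 hr1.le) := by
  obtain ⟨U, hU, h⟩ := hadm.1 v
  obtain ⟨r, hr0, hr1, hr⟩ := exists_congruence_subset (hU.mem_nhds (one_mem U))
  refine ⟨r, hr0, hr1, fun k hk => ?_⟩
  rw [twist_absChar_apply_of_mem_congruence hχ hk, h k (hr hk)]

omit [ValuativeRel F] [TopologicalSpace F] [IsNonarchimedeanLocalField F] in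
theorem eq_bot_or_eq_top_of_twist_invariant (hirr : π.IsIrreducible) (W : Submodule ℂ V)
    (hW : ∀ g, ∀ w ∈ W, twist χ π g w ∈ W) : W = ⊥ ∨ W = ⊤ := by
  have h : ∀ g, ∀ ⦃w⦄, w ∈ W → π g w ∈ W := fun g w hw =>
    (Submodule.smul_mem_iff W (Units.ne_zero _)).1 (hW g w hw)
  rcases hirr.eq_bot_or_eq_top ⟨W, h⟩ with h | h
  · left; exact congrArg Subrepresentation.toSubmodule h
  · right; exact congrArg Subrepresentation.toSubmodule h

/-- Open stabilizers make the orbit map locally constant, hence continuous for the norm topology. -/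
theorem IsAdmissible.continuous_apply (hadm : IsAdmissible π) (v : V) :
    Continuous fun g : GL2 F => π g v := by
  obtain ⟨U, hU, h⟩ := hadm.1 v
  rw [continuous_iff_continuousAt]
  intro g
  refine (continuousAt_const (y := π g v)).congr ?_
  have hmem : ∀ᶠ x in nhds g, g⁻¹ * x ∈ (U : Set (GL2 F)) := by
    have hc : Continuous fun x : GL2 F => g⁻¹ * x := by fun_prop
    exact hc.continuousAt.preimage_mem_nhds (hU.mem_nhds (by simp [one_mem]))
  filter_upwards [hmem] with x hx
  have e : x = g * (g⁻¹ * x) := by group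
  rw [e, map_mul, Module.End.mul_apply, h _ hx]

theorem continuous_localIntegrand {D : F} (hadm : IsAdmissible π) (Ω : torus D →* ℂˣ)
    (hΩcont : Continuous Ω)
    (hΩ : ∀ z : torus D, z ∈ scalarsInTorus D → ∀ w : V, (Ω z : ℂ) • π z w = w) (v : V) :
    Continuous (localIntegrand π v Ω) := by
  rw [(QuotientGroup.isQuotientMap_mk (N := scalarsInTorus D)).continuous_iff]
  have h : Continuous fun e : torus D => matrixCoeff π v e * (Ω e : ℂ) := by
    refine Continuous.mul ?_ (Units.continuous_val.comp hΩcont)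
    refine Continuous.div_const ?_ _
    exact Continuous.inner continuous_const
      ((hadm.continuous_apply v).comp continuous_subtype_val)
  exact h.congr fun e => (localIntegrand_mk π v Ω hΩ e).symm

omit [ValuativeRel F] [TopologicalSpace F] [IsNonarchimedeanLocalField F] in
/-- The absolute value of the local integrand of a translate of `φ`, as a matrix coefficient of the
unitary twist. -/
theorem norm_localIntegrand_apply {D : F} (hπχ : IsUnitaryRep (twist χ π)) (Ω : torus D →* ℂˣ)
    (hΩχ : ∀ e : torus D,
      ‖(Ω e : ℂ) * (χ (Matrix.GeneralLinearGroup.det (e : GL2 F)) : ℂ)⁻¹‖ = 1)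
    (φ : V) (h : GL2 F) (x : TorusModScalars D) :
    ‖localIntegrand π (π h φ) Ω x‖ =
      ‖(inner ℂ φ (twist (absChar χ) π (h⁻¹ * (Quotient.out x : torus D) * h) φ) : ℂ)‖ /
        ‖φ‖ ^ 2 := by
  change ‖matrixCoeff π (π h φ) (Quotient.out x : torus D) * (Ω (Quotient.out x) : ℂ)‖ = _
  generalize (Quotient.out x : torus D) = e
  have hu := hπχ.twist_absChar
  have hΩe : ‖(Ω e : ℂ)‖ = ‖(χ (Matrix.GeneralLinearGroup.det (e : GL2 F)) : ℂ)‖ := by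
    have := hΩχ e
    rwa [norm_mul, norm_inv, ← div_eq_mul_inv, div_eq_one_iff_eq (by simp)] at this
  -- Untwisting `h` multiplies numerator and denominator by `c²`, which cancels; the twist at `e` is
  -- exactly `|Ω(e)|`.
  set c : ℝ := ‖(χ (Matrix.GeneralLinearGroup.det h) : ℂ)‖
  have hc : 0 < c := norm_pos_iff.2 (Units.ne_zero _)
  have h1 : inner ℂ φ (twist (absChar χ) π (h⁻¹ * e * h) φ) =
      inner ℂ (twist (absChar χ) π h φ) (twist (absChar χ) π e (twist (absChar χ) π h φ)) := by
    rw [mul_assoc, map_mul, Module.End.mul_apply, hu.inner_apply_right, inv_inv, map_mul,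
      Module.End.mul_apply]
  have h2 : ‖φ‖ = ‖twist (absChar χ) π h φ‖ := (hu.norm_apply h φ).symm
  have h3 : twist (absChar χ) π h φ = (c : ℂ) • π h φ := rfl
  rw [h1, h2, h3, map_smul, twist_apply, inner_smul_left, inner_smul_right, inner_smul_right,
    matrixCoeff, norm_mul, norm_div, hΩe, norm_mul, norm_mul, norm_mul, norm_smul,
    inner_self_eq_norm_sq_to_K, absChar_apply]
  simp only [Complex.conj_ofReal, Complex.norm_real, norm_norm, norm_pow, RCLike.norm_ofReal,
    abs_norm, Real.norm_of_nonneg hc.le]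
  field_simp

end UnitaryTwist

end LocalWaldspurger

/-! ### The estimate of the local integrals -/

open LocalWaldspurger
theorem proposition3p4
    {F : Type*} [Field F] [ValuativeRel F] [TopologicalSpace F] [IsNonarchimedeanLocalField F]
    [CharZero F]
    (ϖ : Fˣ) (hϖ : ∃ x : 𝒪[F], Irreducible x ∧ (x : F) = ϖ)
    (D : F) (hD : D ≠ 0)
    -- a Haar measure on `F^× \ E^×`, in any normalization
    [MeasurableSpace (TorusModScalars D)] [BorelSpace (TorusModScalars D)]
    (μ : Measure (TorusModScalars D)) [μ.IsHaarMeasure]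
    -- the representation
    {V : Type*} [NormedAddCommGroup V] [InnerProductSpace ℂ V]
    (π : Representation ℂ (GL2 F) V) (hirr : π.IsIrreducible) (hadm : IsAdmissible π)
    (hinf : ¬ FiniteDimensional ℂ V)
    (hπ : IsUnramifiedRep π ∨ IsUnramifiedSpecialRep π)
    -- the character of `E^×`, inverse to the central character of `π` on `F^×`
    (Ω : torus D →* ℂˣ) (hΩcont : Continuous Ω)
    (hΩ : ∀ z : torus D, z ∈ scalarsInTorus D → ∀ w : V, (Ω z : ℂ) • π z w = w)
    -- `π ⊗ χ` and `Ω · (χ ∘ N_{E/F})⁻¹` are unitary for some character `χ` of `F^×`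
    (χ : Fˣ →* ℂˣ) (hχ : Continuous χ) (hπχ : IsUnitaryRep (twist χ π))
    (hΩχ : ∀ e : torus D,
      ‖(Ω e : ℂ) * (χ (Matrix.GeneralLinearGroup.det (e : GL2 F)) : ℂ)⁻¹‖ = 1)
    -- the newform
    (φ : V) (hφ : IsNewform π φ) :
    ∃ δ : ℝ, 0 < δ ∧
      (∀ n : ℕ, Integrable (localIntegrand π (π (diagOne (ϖ ^ (-(n : ℤ)))) φ) Ω) μ) ∧
      (fun n : ℕ => localIntegral μ π (π (diagOne (ϖ ^ (-(n : ℤ)))) φ) Ω) =O[atTop]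
        (fun n : ℕ => (Nat.card 𝓀[F] : ℝ) ^ (-(δ * n))) := by
  have hχ1 : ∀ u : Fˣ, vabs F u = 1 → ‖(χ u : ℂ)‖ = 1 := fun u hu =>
    norm_char_eq_one_of_isNewform hπχ hφ hu
  obtain ⟨r, hr0, hr1, hφr⟩ := exists_mem_fixedVectors_twist hadm hχ1 φ
  obtain ⟨C, s₁, hC, hs₁, hdecay⟩ := exists_norm_inner_le_rpow hπχ.twist_absChar
    (eq_bot_or_eq_top_of_twist_invariant hirr) hinf
    (finiteDimensional_fixedVectors_twist hadm hχ1) hr1 hφr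
  obtain ⟨s₂, hs₂, hint⟩ := exists_lintegral_quotientRatio_lt_top two_ne_zero hD μ
  set s : ℝ := min s₁ s₂
  have hs : 0 < s := lt_min hs₁ hs₂
  have hI := hint s hs (min_le_right _ _)
  set g : TorusModScalars D → ENNReal := fun x => ENNReal.ofReal (quotientRatio x) ^ (-s) with hg
  have hω : 0 < vabs F ϖ ∧ vabs F ϖ < 1 := by
    obtain ⟨x, hx, hxϖ⟩ := hϖ
    rw [← hxϖ]
    exact vabs_irreducible hx
  have hD0 := vabs_pos hD
  have hφ0 : 0 < ‖φ‖ := norm_pos_iff.2 hφ.1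
  set ρ : ℝ := (vabs F ϖ ^ 2) ^ s with hρ
  have hρ0 : 0 < ρ := by have := hω.1; positivity
  have hρ1 : ρ < 1 := Real.rpow_lt_one (by positivity) (pow_lt_one₀ hω.1.le hω.2 two_ne_zero) hs
  -- `C + 1` instead of `C` makes `K` positive, so that `K ρ^n · ⊤ = ⊤` and the bound holds
  -- trivially where `b = 0`, that is, where `g` is infinite.
  set K : ℝ := (C + 1) * (vabs F D ^ 2)⁻¹ ^ s / ‖φ‖ ^ 2 with hK
  have hK0 : 0 < K := by positivity
  set f : ℕ → TorusModScalars D → ℂ :=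
    fun n => localIntegrand π (π (diagOne (ϖ ^ (-(n : ℤ)))) φ) Ω with hf
  have hbound : ∀ n x, ‖f n x‖ₑ ≤ ENNReal.ofReal (K * ρ ^ n) * g x := by
    intro n x
    set e : torus D := Quotient.out x with he
    by_cases hb : (e : GL2 F) 0 1 = 0
    · have h0 : quotientRatio x = 0 := by
        change ratio e = 0
        rw [ratio, hb, map_zero]; simp
      have hgx : g x = ⊤ := by
        rw [hg]
        dsimp only
        rw [h0, ENNReal.ofReal_zero, ENNReal.zero_rpow_of_neg (by linarith)]
      rw [hgx, ENNReal.mul_top (by simpa using mul_pos hK0 (pow_pos hρ0 n))]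
      exact le_top
    · have hvb := vabs_pos hb
      have hN := vabs_pos (torus_det_ne_zero e)
      have hQ : 0 < ratio e := div_pos (by positivity) hN
      rw [← ofReal_norm, hg]
      dsimp only
      rw [show quotientRatio x = ratio e from rfl, ENNReal.ofReal_rpow_of_pos hQ, ← ENNReal.ofReal_mul (by positivity)]
      refine ENNReal.ofReal_le_ofReal ?_
      rw [hf]
      dsimp only
      rw [norm_localIntegrand_apply hπχ Ω hΩχ]
      set a : Fˣ := ϖ ^ (-(n : ℤ)) with ha
      have hva : vabs F (a : F) = (vabs F ϖ ^ n)⁻¹ := by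
        rw [ha, zpow_neg, zpow_natCast, Units.val_inv_eq_inv_val, map_inv₀,
          Units.val_pow_eq_pow_val, map_pow]
      -- The decay estimate is applied to the entry that conjugation enlarges, of absolute value
      -- `|ϖ|⁻ⁿ |b D|`.
      have h10 : ((diagOne a)⁻¹ * (e : GL2 F) * diagOne a : GL2 F) 1 0 =
          a * ((e : GL2 F) 0 1 * D) := by
        rw [coe_conj_diagOne, torus_apply_one_zero]; rfl
      have hd := hdecay s hs (min_le_left _ _) ((diagOne a)⁻¹ * e * diagOne a) 1 0 (by
        rw [h10]; exact mul_ne_zero a.ne_zero (mul_ne_zero hb hD))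
      rw [h10, det_conj, map_mul (vabs F), map_mul (vabs F), hva] at hd
      have hω0 := hω.1
      have harg : vabs F ((e : GL2 F) : Matrix (Fin 2) (Fin 2) F).det /
          ((vabs F ϖ ^ n)⁻¹ * (vabs F ((e : GL2 F) 0 1) * vabs F D)) ^ 2 =
          (vabs F ϖ ^ 2) ^ n * ((vabs F D ^ 2)⁻¹ * (ratio e)⁻¹) := by
        rw [ratio]
        field_simp
        ring
      have hrpow : ((vabs F ϖ ^ 2) ^ n * ((vabs F D ^ 2)⁻¹ * (ratio e)⁻¹)) ^ s =
          ρ ^ n * ((vabs F D ^ 2)⁻¹ ^ s * ratio e ^ (-s)) := by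
        rw [Real.mul_rpow (by positivity) (by positivity),
          Real.mul_rpow (by positivity) (by positivity), Real.inv_rpow hQ.le, ← Real.rpow_neg hQ.le,
          hρ, Real.rpow_pow_comm (by positivity)]
      rw [harg, hrpow] at hd
      rw [div_le_iff₀ (by positivity)]
      refine hd.trans ?_
      have hK' : K * ρ ^ n * ratio e ^ (-s) * ‖φ‖ ^ 2 =
          (C + 1) * (ρ ^ n * ((vabs F D ^ 2)⁻¹ ^ s * ratio e ^ (-s))) := by
        rw [hK]
        field_simp
      rw [hK']
      exact mul_le_mul_of_nonneg_right (by linarith) (by positivity)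
  have hlint : ∀ n, ∫⁻ x, ‖f n x‖ₑ ∂μ ≤ ENNReal.ofReal (K * ρ ^ n) * ∫⁻ x, g x ∂μ := by
    intro n
    rw [← lintegral_const_mul' _ _ ENNReal.ofReal_ne_top]
    exact lintegral_mono (hbound n)
  have hq : (1 : ℝ) < Nat.card 𝓀[F] := by exact_mod_cast Finite.one_lt_card
  have hlogq := Real.log_pos hq
  have hlogρ := Real.log_neg hρ0 hρ1
  -- `δ` is defined by `q ^ (-δ) = ρ`; the residue cardinality enters only here, so the
  -- normalization of `vabs` does not matter.
  refine ⟨-Real.log ρ / Real.log (Nat.card 𝓀[F]), div_pos (by linarith) hlogq, fun n => ?_, ?_⟩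
  · refine ⟨(continuous_localIntegrand hadm Ω hΩcont hΩ _).aestronglyMeasurable, ?_⟩
    exact (hlint n).trans_lt (ENNReal.mul_lt_top ENNReal.ofReal_lt_top hI)
  · refine IsBigO.of_bound (K * (∫⁻ x, g x ∂μ).toReal) (Eventually.of_forall fun n => ?_)
    have hpow : (Nat.card 𝓀[F] : ℝ) ^ (-(-Real.log ρ / Real.log (Nat.card 𝓀[F]) * n)) = ρ ^ n := by
      rw [Real.rpow_def_of_pos (by linarith), ← Real.rpow_natCast, Real.rpow_def_of_pos hρ0]
      congr 1
      field_simp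
    rw [hpow, Real.norm_of_nonneg (by positivity)]
    have h1 : ‖∫ x, f n x ∂μ‖ₑ ≤ ENNReal.ofReal (K * ρ ^ n) * ∫⁻ x, g x ∂μ :=
      (enorm_integral_le_lintegral_enorm _).trans (hlint n)
    have h2 := ENNReal.toReal_mono (ENNReal.mul_ne_top ENNReal.ofReal_ne_top hI.ne) h1
    rw [toReal_enorm, ENNReal.toReal_mul, ENNReal.toReal_ofReal (by positivity)] at h2
    refine h2.trans (le_of_eq ?_)
    ring
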